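/- \textbf{Effective embedding theorem.} A \emph{computable metric space} is a complete metric space $X$ with a dense sequence $(x_n)_{n\in\mathbb N}$ such that the reals $d(x_n,x_m)$ are computable uniformly in $n,m$. A function $\gamma:\mathbb N\to\mathbb N$ \emph{represents} $x\in X$ if $d(x_{\gamma(n)},x_{\gamma(n+1)})\le 2^{-n}$ for all $n$ and $x=\lim_n x_{\gamma(n)}$; a function between such spaces is \emph{externally computable} if some partial computable functional $\mathbb N^{\mathbb N}\to\mathbb N^{\mathbb N}$ sends every representative of an argument to a representative of the value. A \emph{computable Banach space} is a real Banach space that is, with a dense sequence $(y_m)$, a computable metric space in the norm metric, with externally computable addition and scalar multiplication. Let $U$ be the Urysohn space with a computable presentation, i.e. $U$ is a computable metric space with dense sequence $(u_n)$, and whenever $A\subseteq B$ are finite metric spaces, every isometric embedding $A\to U$ extends to an isometric embedding $B\to U$. Finite types $\sigma(\vec X)$ in the variables $X_1,\dots,X_k$ are generated from the variables by $(\delta,\tau)\mapsto(\delta\to\tau)$. They, and finite products, are interpreted in the cartesian closed category of limit spaces: a metric space carries its convergent sequences, $\delta\to\tau$ is the set of functions preserving limits of sequences, and $f_n\to f$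 in $\delta\to\tau$ iff $f_n(a_n)\to f(a)$ whenever $a_n\to a$. Given computable Banach spaces $M_1,\dots,M_k$, the \emph{internally computable} functions form the smallest class of partial functions between the spaces obtained from the base sets $\mathbb N,\mathbb R,U,M_1,\dots,M_k$ by finite products and function spaces that contains: successor and constants on $\mathbb N$; the constant $1$, addition, subtraction, multiplication and absolute value on $\mathbb R$; $n\mapsto u_n$ and $d_U$; for each $i$ the enumeration $m\mapsto y_m$ of the dense sequence of $M_i$, and addition, scalar multiplication and norm of $M_i$; and that is closed under composition, projections and tupling, application and $\lambda$-abstraction, primitive recursion with values in a base set, $\mu$-recursion, and the following operators (applied with parameters). (1) \emph{Case} (with values in a base set): $Case(f,g,y)(x)$ is $f(x)$ if $x<y$, is $g(x)$ if $y<x$, and is the common value $f(y)=g(y)$ if $x=y$ and these are defined and equal (otherwise undefined). (2) \emph{Modified limit} in $E\in\{\mathbb R,M_1,\dots,M_k\}$: $(w_j)\mapsto\lim_j w^m_j$, where $w^m_0=w_0$ and $w^m_{j+1}=w^m_j+\lambda_j(w_{j+1}-w^m_j)$, with $\lambda_j=1$ if $\|w_{j+1}-w^m_j\|\le2^{-j}$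 and $\lambda_j=2^{-j}/\|w_{j+1}-w^m_j\|$ otherwise. (3) \emph{Accumulation} in $E\in\{\mathbb R,M_1,\dots,M_k\}$: for $f:\mathbb N\to\mathbb R_{\ge0}$ and $g:\mathbb N\to E$, $\bar\alpha(f,g)=\sum_{i<n}f(i)g(i)+\bigl(1-\sum_{i<n}f(i)\bigr)g(n)$, where $\sum_{i<n}f(i)\le1<\sum_{i\le n}f(i)$; undefined if there is no such $n$. (4) \emph{Limits of distributions in $U$}: to a sequence $(\mu_j)$ of probability distributions on $\mathbb N$ such that $(u_{\gamma(j)})_j$ satisfies $d(u_{\gamma(j)},u_{\gamma(j+1)})\le2^{-j}$ for all $j$ whenever $\mu_j(\gamma(j))>0$ for all $j$, it assigns the common limit of these sequences; undefined for other sequences. \textbf{Statement.} For every finite type $\sigma(X_1,\dots,X_k)$ and all computable Banach spaces $M_1,\dots,M_k$, the space $\sigma(M_1,\dots,M_k)$ is a retract of $\sigma(U,\dots,U)$ by internally computable maps: there are continuous (i.e. sequential-limit-preserving) maps $e:\sigma(\vec M)\to\sigma(\vec U)$ and $r:\sigma(\vec U)\to\sigma(\vec M)$ with $r\circ e=\mathrm{id}$,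 both of which are internally computable. -/

import Mathlib

open Filter Topology

noncomputable section

namespace BanachTypes

/-! ## Computable metric spaces, external computability, computable Banach spaces -/

/-- The distances between the points of the enumerated set `{s n | n ∈ ℕ}` are computable reals,
uniformly: `q (n, m, k) / 2 ^ k` approximates the distance of `s n` and `s m` up to `1 / 2 ^ k`. -/
def ComputableDist {X : Type} [MetricSpace X] (s : ℕ → X) : Prop :=
  ∃ q : ℕ × ℕ × ℕ → ℕ, Computable q ∧
    ∀ n m k : ℕ, |dist (s n) (s m) - (q (n, m, k) : ℝ) / 2 ^ k| ≤ 1 / 2 ^ k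

/-- A computable metric space: the completion of a computable metric on an enumerated set
(repetitions in the enumeration are allowed). -/
structure ComputableMetricSpace where
  carrier : Type
  [metric : MetricSpace carrier]
  [complete : CompleteSpace carrier]
  pt : ℕ → carrier
  dense : DenseRange pt
  computableDist : ComputableDist pt

attribute [instance] ComputableMetricSpace.metric ComputableMetricSpace.complete

/-- `γ` represents `x` with respect to the enumerated dense set `s`: the sequence `s (γ n)` is
fast converging and has limit `x`. -/
def Represents {X : Type} [MetricSpace X] (s : ℕ → X) (γ : ℕ → ℕ) (x : X) : Prop :=
  (∀ n, dist (s (γ n)) (s (γ (n + 1))) ≤ 1 / 2 ^ n) ∧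
    Tendsto (fun n => s (γ n)) atTop (𝓝 x)

/-- The finite sequence `γ 0, …, γ (n - 1)`. -/
def initSeg (γ : ℕ → ℕ) (n : ℕ) : List ℕ := (List.range n).map γ

/-- `F : Seq → Seq` sends `γ` to `ξ` in the limit. -/
def MapsInLimit (F : List ℕ → List ℕ) (γ ξ : ℕ → ℕ) : Prop :=
  (∀ m, F (initSeg γ m) = initSeg ξ (F (initSeg γ m)).length) ∧
    ∀ n, ∃ m, n ≤ (F (initSeg γ m)).length

/-- External computability of a total function between metric spaces with enumerated dense
subsets. The partial computable functional on `ℕ → ℕ` is given by a computable function on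
finite sequences that is increasing for the initial segment ordering. -/
def ExternallyComputable {X Y : Type} [MetricSpace X] [MetricSpace Y]
    (s : ℕ → X) (t : ℕ → Y) (f : X → Y) : Prop :=
  ∃ F : List ℕ → List ℕ, Computable F ∧ (∀ l l' : List ℕ, l <+: l' → F l <+: F l') ∧
    ∀ γ x, Represents s γ x → ∃ ξ, MapsInLimit F γ ξ ∧ Represents t ξ (f x)

/-- The standard enumeration of the rational numbers as a dense subset of `ℝ`. -/
def realPt (n : ℕ) : ℝ :=
  ((n.unpair.1.unpair.1 : ℝ) - (n.unpair.1.unpair.2 : ℝ)) / ((n.unpair.2 : ℝ) + 1)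

/-- The enumerated dense subset of a product (with the maximum metric). -/
def prodPt {X Y : Type} (s : ℕ → X) (t : ℕ → Y) (n : ℕ) : X × Y :=
  (s n.unpair.1, t n.unpair.2)

/-- A computable Banach space: a real Banach space that is a computable metric space in the
metric given by the norm, with computable addition and multiplication with scalars. -/
structure ComputableBanachSpace where
  carrier : Type
  [normed : NormedAddCommGroup carrier]
  [space : NormedSpace ℝ carrier]
  [complete : CompleteSpace carrier]
  pt : ℕ → carrier
  dense : DenseRange pt
  computableDist : ComputableDist pt
  computableAdd : ExternallyComputable (prodPt pt pt) pt (fun p : carrier × carrier => p.1 + p.2)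
  computableSmul : ExternallyComputable (prodPt realPt pt) pt (fun p : ℝ × carrier => p.1 • p.2)

attribute [instance] ComputableBanachSpace.normed ComputableBanachSpace.space
  ComputableBanachSpace.complete

/-! ## The Urysohn space -/

/-- A computable metric space is (a computable presentation of) the Urysohn space if every
isometric embedding of a subspace `A` of a finite metric space `B` extends to an isometric
embedding of `B`. (Completeness and separability are part of `ComputableMetricSpace`.) -/
def ComputableMetricSpace.IsUrysohn (U : ComputableMetricSpace) : Prop :=
  ∀ (B : Type) [MetricSpace B] [Finite B] (A : Set B) (f : A → U.carrier), Isometry f →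
    ∃ g : B → U.carrier, Isometry g ∧ ∀ a : A, g a = f a

/-! ## Sequential convergence and the types -/

/-- A set with a convergence relation for sequences. Only the Kuratowski limit spaces that are
obtained from metric spaces by products and function spaces are used. -/
structure LimSpace where
  carrier : Type
  Lim : (ℕ → carrier) → carrier → Prop

/-- The limit space of a metric space. -/
abbrev LimSpace.ofMetric (X : Type) [MetricSpace X] : LimSpace :=
  ⟨X, fun s x => Tendsto s atTop (𝓝 x)⟩

/-- Continuous functions between limit spaces: those preserving limits of sequences. -/
structure LimSpace.Hom (L K : LimSpace) where
  toFun : L.carrier → K.carrier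
  map_lim : ∀ s x, L.Lim s x → K.Lim (fun n => toFun (s n)) (toFun x)

instance (L K : LimSpace) : CoeFun (LimSpace.Hom L K) (fun _ => L.carrier → K.carrier) :=
  ⟨LimSpace.Hom.toFun⟩

/-- The limit space of continuous functions, with continuous convergence. -/
abbrev LimSpace.fn (L K : LimSpace) : LimSpace :=
  ⟨LimSpace.Hom L K, fun F f => ∀ s x, L.Lim s x → K.Lim (fun n => F n (s n)) (f x)⟩

abbrev LimSpace.prod (L K : LimSpace) : LimSpace :=
  ⟨L.carrier × K.carrier,
    fun s x => L.Lim (fun n => (s n).1) x.1 ∧ K.Lim (fun n => (s n).2) x.2⟩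

abbrev LimSpace.unit : LimSpace := ⟨Unit, fun _ _ => True⟩

/-- The base sets: `ℕ`, `ℝ`, the metric space `X` and the Banach spaces `M 0, …, M (k - 1)`. -/
inductive Base (k : ℕ) where
  | nat : Base k
  | real : Base k
  | met : Base k
  | ban : Fin k → Base k

/-- Types over the base sets, with finite products and function types. -/
inductive Ty (k : ℕ) where
  | base : Base k → Ty k
  | unit : Ty k
  | prod : Ty k → Ty k → Ty k
  | arrow : Ty k → Ty k → Ty k

/-- The finite types `σ(X₀, …, Xₖ₋₁)` in the type variables `X₀, …, Xₖ₋₁`. -/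
inductive FinType (k : ℕ) where
  | var : Fin k → FinType k
  | arrow : FinType k → FinType k → FinType k

/-- `σ(b₀, …, bₖ₋₁)`, where base sets are put in for the type variables. -/
def FinType.subst {k : ℕ} (b : Fin k → Base k) : FinType k → Ty k
  | .var i => .base (b i)
  | .arrow δ τ => .arrow (δ.subst b) (τ.subst b)

section Calculus

variable (X : ComputableMetricSpace) {k : ℕ} (M : Fin k → ComputableBanachSpace)

abbrev Base.space : Base k → LimSpace
  | .nat => LimSpace.ofMetric ℕ
  | .real => LimSpace.ofMetric ℝ
  | .met => LimSpace.ofMetric X.carrier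
  | .ban i => LimSpace.ofMetric (M i).carrier

/-- The interpretation of the types in the cartesian closed category of limit spaces. -/
abbrev Ty.space : Ty k → LimSpace
  | .base b => b.space X M
  | .unit => LimSpace.unit
  | .prod A B => (Ty.space A).prod (Ty.space B)
  | .arrow A B => (Ty.space A).fn (Ty.space B)

/-- The elements of a type. -/
abbrev Ty.El (A : Ty k) : Type := (A.space X M).carrier

end Calculus

/-! ## The operators -/

/-- The modified sequence. -/
def modSeq {E : Type} [NormedAddCommGroup E] [NormedSpace ℝ E] (w : ℕ → E) : ℕ → E
  | 0 => w 0
  | j + 1 => modSeq w j +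
      (if ‖w (j + 1) - modSeq w j‖ ≤ 1 / 2 ^ j then (1 : ℝ)
        else (1 / 2 ^ j) / ‖w (j + 1) - modSeq w j‖) • (w (j + 1) - modSeq w j)

/-- `v` is the modified limit of the sequence `w`. -/
def IsModLim {E : Type} [NormedAddCommGroup E] [NormedSpace ℝ E] (w : ℕ → E) (v : E) : Prop :=
  Tendsto (modSeq w) atTop (𝓝 v)

/-- The accumulation operator is defined on `(f, g)` and has value `v`, where the argument `f`
is a sequence of nonnegative reals. -/
def IsAccum {E : Type} [NormedAddCommGroup E] [NormedSpace ℝ E]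
    (f : ℕ → ℝ) (g : ℕ → E) (v : E) : Prop :=
  (∀ i, 0 ≤ f i) ∧ ∃ n : ℕ,
    ∑ i ∈ Finset.range n, f i ≤ 1 ∧ 1 < ∑ i ∈ Finset.range (n + 1), f i ∧
    v = ∑ i ∈ Finset.range n, f i • g i + (1 - ∑ i ∈ Finset.range n, f i) • g n

/-- `z` is the value at `x` of `Case(f, g, y)`. -/
def IsCase {E : Type} (f g : ℝ →. E) (y x : ℝ) (z : E) : Prop :=
  (x < y ∧ z ∈ f x) ∨ (y < x ∧ z ∈ g x) ∨ (x = y ∧ z ∈ f y ∧ z ∈ g y)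

/-- `μ 0, μ 1, …` is a fast converging sequence of probability distributions on `ℕ` (with respect
to the enumerated set `s`), with limit `x`. -/
def IsDistLim {Y : Type} [MetricSpace Y] (s : ℕ → Y) (μ : ℕ → ℕ → ℝ) (x : Y) : Prop :=
  (∀ j, (∀ n, 0 ≤ μ j n) ∧ HasSum (μ j) 1) ∧
  ∀ γ : ℕ → ℕ, (∀ j, 0 < μ j (γ j)) → Represents s γ x

/-- A total function, as a partial function. -/
def tot {α β : Type} (f : α → β) : α →. β := fun a => Part.some (f a)

/-! ## Internally computable functions -/

/-- The internally computable partial functions between the types over `ℕ`, `ℝ`, `X` and the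
`M i`. -/
inductive InternallyComputable (X : ComputableMetricSpace) {k : ℕ}
    (M : Fin k → ComputableBanachSpace) :
    {A B : Ty k} → (A.El X M →. B.El X M) → Prop
  -- successor and constants on `ℕ`, the constant `1` on `ℝ`
  | natConst (n : ℕ) :
      InternallyComputable X M (A := .unit) (B := .base .nat) (tot (α := Unit) (β := ℕ) fun _ => n)
  | succ : InternallyComputable X M (A := .base .nat) (B := .base .nat) (tot Nat.succ)
  | realOne : InternallyComputable X M (A := .unit) (B := .base .real) (tot (α := Unit) (β := ℝ) fun _ => 1)
  -- addition, subtraction, multiplication and absolute value on `ℝ`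
  | realAdd : InternallyComputable X M
      (A := .prod (.base .real) (.base .real)) (B := .base .real)
      (tot (α := ℝ × ℝ) (β := ℝ) fun p => p.1 + p.2)
  | realSub : InternallyComputable X M
      (A := .prod (.base .real) (.base .real)) (B := .base .real)
      (tot (α := ℝ × ℝ) (β := ℝ) fun p => p.1 - p.2)
  | realMul : InternallyComputable X M
      (A := .prod (.base .real) (.base .real)) (B := .base .real)
      (tot (α := ℝ × ℝ) (β := ℝ) fun p => p.1 * p.2)
  | realAbs : InternallyComputable X M (A := .base .real) (B := .base .real)
      (tot (α := ℝ) (β := ℝ) fun x => |x|)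
  -- the enumerated dense subset and the metric of `X`
  | metPt : InternallyComputable X M (A := .base .nat) (B := .base .met) (tot X.pt)
  | metDist : InternallyComputable X M
      (A := .prod (.base .met) (.base .met)) (B := .base .real)
      (tot (α := X.carrier × X.carrier) (β := ℝ) fun p => dist p.1 p.2)
  -- the enumerated dense subset and the structure of `M i`
  | banPt (i : Fin k) : InternallyComputable X M (A := .base .nat) (B := .base (.ban i))
      (tot (M i).pt)
  | banAdd (i : Fin k) : InternallyComputable X M
      (A := .prod (.base (.ban i)) (.base (.ban i))) (B := .base (.ban i))
      (tot (α := (M i).carrier × (M i).carrier) (β := (M i).carrier) fun p => p.1 + p.2)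
  | banSmul (i : Fin k) : InternallyComputable X M
      (A := .prod (.base .real) (.base (.ban i))) (B := .base (.ban i))
      (tot (α := ℝ × (M i).carrier) (β := (M i).carrier) fun p => p.1 • p.2)
  | banNorm (i : Fin k) : InternallyComputable X M (A := .base (.ban i)) (B := .base .real)
      (tot (α := (M i).carrier) (β := ℝ) fun x => ‖x‖)
  -- composition and dummy arguments
  | ident (A : Ty k) : InternallyComputable X M (A := A) (B := A) (tot fun x => x)
  | comp {A B C : Ty k} {g : B.El X M →. C.El X M} {f : A.El X M →. B.El X M} :
      InternallyComputable X M g → InternallyComputable X M f →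
      InternallyComputable X M (A := A) (B := C) (fun a => (f a).bind g)
  | terminal (A : Ty k) : InternallyComputable X M (A := A) (B := .unit) (tot fun _ => ())
  | fst (A B : Ty k) : InternallyComputable X M (A := .prod A B) (B := A)
      (tot fun p : A.El X M × B.El X M => p.1)
  | snd (A B : Ty k) : InternallyComputable X M (A := .prod A B) (B := B)
      (tot fun p : A.El X M × B.El X M => p.2)
  | pair {A B C : Ty k} {f : A.El X M →. B.El X M} {g : A.El X M →. C.El X M} :
      InternallyComputable X M f → InternallyComputable X M g →
      InternallyComputable X M (A := A) (B := .prod B C)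
        (fun a => (f a).bind fun b => (g a).map fun c => (b, c))
  -- application and abstraction at function types
  | eval (A B : Ty k) : InternallyComputable X M (A := .prod (.arrow A B) A) (B := B)
      (tot fun p : LimSpace.Hom (A.space X M) (B.space X M) × A.El X M => p.1 p.2)
  | curry {A B C : Ty k} {f : A.El X M × B.El X M →. C.El X M}
      {h : A.El X M →. LimSpace.Hom (B.space X M) (C.space X M)} :
      InternallyComputable X M (A := .prod A B) (B := C) f →
      (∀ a F, F ∈ h a ↔ ∀ b, F b ∈ f (a, b)) →
      InternallyComputable X M (A := A) (B := .arrow B C) h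
  -- primitive recursion, with values in a base set
  | primRec {A : Ty k} {b : Base k} {f : A.El X M →. (Ty.base b).El X M}
      {g : A.El X M × (ℕ × (Ty.base b).El X M) →. (Ty.base b).El X M} :
      InternallyComputable X M f →
      InternallyComputable X M (A := .prod A (.prod (.base .nat) (.base b))) (B := .base b) g →
      InternallyComputable X M (A := .prod A (.base .nat)) (B := .base b)
        (fun p : A.El X M × ℕ =>
          Nat.rec (f p.1) (fun m v => v.bind fun y => g (p.1, (m, y))) p.2)
  -- `μ`-recursion
  | muRec {A : Ty k} {f : A.El X M × ℕ →. ℕ} {h : A.El X M →. ℕ} :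
      InternallyComputable X M (A := .prod A (.base .nat)) (B := .base .nat) f →
      (∀ a n, n ∈ h a ↔ 0 ∈ f (a, n) ∧ ∀ m < n, ∃ y, y ≠ 0 ∧ y ∈ f (a, m)) →
      InternallyComputable X M (A := A) (B := .base .nat) h
  -- the Case operator, with values in a base set
  | caseOp {A : Ty k} {b : Base k} {f g : A.El X M × ℝ →. (Ty.base b).El X M}
      {h : A.El X M × (ℝ × ℝ) →. (Ty.base b).El X M} :
      InternallyComputable X M (A := .prod A (.base .real)) (B := .base b) f →
      InternallyComputable X M (A := .prod A (.base .real)) (B := .base b) g →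
      (∀ a y x z, z ∈ h (a, (y, x)) ↔ IsCase (fun t => f (a, t)) (fun t => g (a, t)) y x z) →
      InternallyComputable X M (A := .prod A (.prod (.base .real) (.base .real))) (B := .base b) h
  -- the modified limit operator for `ℝ` and `M i`
  | realModLim {A : Ty k} {w : A.El X M × ℕ →. ℝ} {h : A.El X M →. ℝ} :
      InternallyComputable X M (A := .prod A (.base .nat)) (B := .base .real) w →
      (∀ a v, v ∈ h a ↔ ∃ w' : ℕ → ℝ, (∀ n, w' n ∈ w (a, n)) ∧ IsModLim w' v) →
      InternallyComputable X M (A := A) (B := .base .real) h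
  | banModLim {A : Ty k} (i : Fin k) {w : A.El X M × ℕ →. (M i).carrier}
      {h : A.El X M →. (M i).carrier} :
      InternallyComputable X M (A := .prod A (.base .nat)) (B := .base (.ban i)) w →
      (∀ a v, v ∈ h a ↔ ∃ w' : ℕ → (M i).carrier, (∀ n, w' n ∈ w (a, n)) ∧ IsModLim w' v) →
      InternallyComputable X M (A := A) (B := .base (.ban i)) h
  -- the accumulation operator for `ℝ` and `M i`
  | realAccum {A : Ty k} {f : A.El X M × ℕ →. ℝ} {g : A.El X M × ℕ →. ℝ} {h : A.El X M →. ℝ} :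
      InternallyComputable X M (A := .prod A (.base .nat)) (B := .base .real) f →
      InternallyComputable X M (A := .prod A (.base .nat)) (B := .base .real) g →
      (∀ a v, v ∈ h a ↔ ∃ (f' : ℕ → ℝ) (g' : ℕ → ℝ), (∀ n, f' n ∈ f (a, n)) ∧
        (∀ n, g' n ∈ g (a, n)) ∧ IsAccum f' g' v) →
      InternallyComputable X M (A := A) (B := .base .real) h
  | banAccum {A : Ty k} (i : Fin k) {f : A.El X M × ℕ →. ℝ}
      {g : A.El X M × ℕ →. (M i).carrier} {h : A.El X M →. (M i).carrier} :
      InternallyComputable X M (A := .prod A (.base .nat)) (B := .base .real) f →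
      InternallyComputable X M (A := .prod A (.base .nat)) (B := .base (.ban i)) g →
      (∀ a v, v ∈ h a ↔ ∃ (f' : ℕ → ℝ) (g' : ℕ → (M i).carrier), (∀ n, f' n ∈ f (a, n)) ∧
        (∀ n, g' n ∈ g (a, n)) ∧ IsAccum f' g' v) →
      InternallyComputable X M (A := A) (B := .base (.ban i)) h
  -- the limit operator for fast converging sequences of probability distributions in `X`
  | metDistLim {A : Ty k} {μ : A.El X M × (ℕ × ℕ) →. ℝ} {h : A.El X M →. X.carrier} :
      InternallyComputable X M (A := .prod A (.prod (.base .nat) (.base .nat)))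
        (B := .base .real) μ →
      (∀ a x, x ∈ h a ↔ ∃ μ' : ℕ → ℕ → ℝ, (∀ j n, μ' j n ∈ μ (a, (j, n))) ∧
        IsDistLim X.pt μ' x) →
      InternallyComputable X M (A := A) (B := .base .met) h

end BanachTypes

end

open BanachTypes

/-! The arrow case is formal: if `(e, r)` and `(e', r')` are retractions for `δ` and `τ`, then `F ↦
e' ∘ F ∘ r` and `G ↦ r' ∘ G ∘ e` form one for `δ → τ`, and λ-abstraction keeps them internally
computable. All the content is in the base case, where a computable Banach space `E` with dense
sequence `y` must be a retract of `U` (`exists_retraction_base`).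

The embedding is isometric, but it has to be built with care. Given `u n`, searching for a dense
point of `E` whose image is close to `u n` never ends when `u n` is far from the image, whereas the
retraction has to be total. So finite approximate copies of `y 0, …, y s` in `U` are constructed in
such a way that each new point is, up to a summable error, no closer to `u 0, …, u s` than some
older point. The extension property of `U` allows this, because the new points may be amalgamated
freely over the old ones (`exists_extension`). The distance from `u n` to the image is then almost
attained among finitely many points known in advance, and a bounded search suffices
(`exists_effective_embedding`).

A point of `E` or `U` does not determine an approximating index continuously. Instead all indices
near it are used at once, weighted by bump functions. Accumulation turns the weights into a locally
finite partition of unity. For `e` this gives probability distributions concentrating at `e x`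
(`isDistLim_accum`). For `r` it gives convex combinations of dense points of `E`, whose modified
limit exists and depends continuously on the argument on all of `U`. On the image the combinations
converge so fast that nothing is modified, hence `r ∘ e = id` (`modLim_accum_eq`). -/

namespace BanachTypes

/-! ## Total internally computable functions -/

section Total

variable {X : ComputableMetricSpace} {k : ℕ} {M : Fin k → ComputableBanachSpace}

/-- A total function that is internally computable. -/
def TotComp (X : ComputableMetricSpace) {k : ℕ} (M : Fin k → ComputableBanachSpace) (A B : Ty k)
    (f : A.El X M → B.El X M) : Prop :=
  InternallyComputable X M (A := A) (B := B) (tot f)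

theorem mem_tot {α β : Type} {f : α → β} {a : α} {b : β} : b ∈ tot f a ↔ b = f a :=
  Part.mem_some_iff

namespace TotComp

theorem of_eq {A B : Ty k} {f g : A.El X M → B.El X M} (hf : TotComp X M A B f)
    (h : ∀ a, f a = g a) : TotComp X M A B g :=
  (funext h : f = g) ▸ hf

theorem id (A : Ty k) : TotComp X M A A fun x => x := .ident A

theorem comp {A B C : Ty k} {g : B.El X M → C.El X M} {f : A.El X M → B.El X M}
    (hg : TotComp X M B C g) (hf : TotComp X M A B f) : TotComp X M A C fun a => g (f a) := by
  have h := InternallyComputable.comp hg hf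
  have e : (fun a => (tot f a).bind (tot g)) = tot fun a => g (f a) :=
    funext fun a => Part.bind_some _ _
  rw [e] at h
  exact h

theorem pair {A B C : Ty k} {f : A.El X M → B.El X M} {g : A.El X M → C.El X M}
    (hf : TotComp X M A B f) (hg : TotComp X M A C g) :
    TotComp X M A (.prod B C) fun a => (f a, g a) := by
  have h := InternallyComputable.pair hf hg
  have e : (fun a => (tot f a).bind fun b => (tot g a).map fun c => (b, c)) =
      tot fun a => (f a, g a) :=
    funext fun a => (Part.bind_some _ _).trans (Part.map_some _ _)
  rw [e] at h
  exact h

theorem fst {A B C : Ty k} {f : C.El X M → A.El X M × B.El X M}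
    (hf : TotComp X M C (.prod A B) f) : TotComp X M C A fun c => (f c).1 :=
  comp (InternallyComputable.fst A B) hf

theorem snd {A B C : Ty k} {f : C.El X M → A.El X M × B.El X M}
    (hf : TotComp X M C (.prod A B) f) : TotComp X M C B fun c => (f c).2 :=
  comp (InternallyComputable.snd A B) hf

theorem app {A B C : Ty k} {F : C.El X M → LimSpace.Hom (A.space X M) (B.space X M)}
    {f : C.El X M → A.El X M} (hF : TotComp X M C (.arrow A B) F) (hf : TotComp X M C A f) :
    TotComp X M C B fun c => F c (f c) :=
  comp (InternallyComputable.eval A B) (hF.pair hf)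

theorem curry {A B C : Ty k} {h : A.El X M → LimSpace.Hom (B.space X M) (C.space X M)}
    (hf : TotComp X M (.prod A B) C fun p : A.El X M × B.El X M => h p.1 p.2) :
    TotComp X M A (.arrow B C) h := by
  refine InternallyComputable.curry hf fun a F => ?_
  simp only [mem_tot]
  refine ⟨fun e b => by rw [e], fun e => ?_⟩
  cases F with
  | mk F hF =>
    cases hh : h a with
    | mk G hG =>
      congr 1
      funext b
      exact (e b).trans (by rw [hh])

/-! ### Natural numbers -/

theorem natConst (A : Ty k) (n : ℕ) : TotComp X M A (.base .nat) fun _ => n :=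
  comp (B := .unit) (f := fun _ => ()) (InternallyComputable.natConst n)
    (InternallyComputable.terminal A)

theorem succ {A : Ty k} {f : A.El X M → ℕ} (hf : TotComp X M A (.base .nat) f) :
    TotComp X M A (.base .nat) fun a => (f a).succ :=
  comp (f := f) InternallyComputable.succ hf

theorem primRec {A : Ty k} {b : Base k} {f : A.El X M → (Ty.base b).El X M}
    {g : A.El X M × (ℕ × (Ty.base b).El X M) → (Ty.base b).El X M} {n : A.El X M → ℕ}
    (hf : TotComp X M A (.base b) f)
    (hg : TotComp X M (.prod A (.prod (.base .nat) (.base b))) (.base b) g)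
    (hn : TotComp X M A (.base .nat) n) :
    TotComp X M A (.base b) fun a =>
      Nat.rec (motive := fun _ => (Ty.base b).El X M) (f a) (fun m v => g (a, (m, v))) (n a) := by
  have h := InternallyComputable.primRec hf hg
  have e : (fun p : A.El X M × ℕ => (Nat.rec (tot f p.1)
        (fun m v => v.bind fun y => tot g (p.1, (m, y))) p.2 : Part ((Ty.base b).El X M))) =
      tot fun p => Nat.rec (motive := fun _ => (Ty.base b).El X M) (f p.1)
        (fun m v => g (p.1, (m, v))) p.2 := by
    funext p
    obtain ⟨a, n⟩ := p
    induction n with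
    | zero => rfl
    | succ n ih => exact (congrArg (fun v => Part.bind v _) ih).trans (Part.bind_some _ _)
  rw [e] at h
  exact comp (A := A) (B := .prod A (.base .nat)) (f := fun a => (a, n a)) h
    ((TotComp.id A).pair hn)

theorem of_primrec' {n : ℕ} {f : List.Vector ℕ n → ℕ} (hf : Nat.Primrec' f) :
    ∀ {A : Ty k} (x : Fin n → A.El X M → ℕ), (∀ i, TotComp X M A (.base .nat) (x i)) →
      TotComp X M A (.base .nat) fun a => f (List.Vector.ofFn fun i => x i a) := by
  induction hf with
  | zero => exact fun x _ => natConst _ 0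
  | succ =>
    intro A x hx
    exact (succ (hx 0)).of_eq fun a => by simp
  | get i =>
    intro A x hx
    exact (hx i).of_eq fun a => by simp
  | comp g _ _ hf hg =>
    intro A x hx
    exact hf (fun i a => g i (List.Vector.ofFn fun j => x j a)) fun i => hg i x hx
  | @prec n f g _ _ hf hg =>
    intro A x hx
    -- The argument order of `Nat.Primrec'.prec`: counter, previous value, parameters.
    let y : Fin (n + 2) → A.El X M × (ℕ × ℕ) → ℕ :=
      Fin.cons (fun p => p.2.1) (Fin.cons (fun p => p.2.2) fun i p => x i.succ p.1)
    have hp : TotComp X M (.prod A (.prod (.base .nat) (.base .nat)))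
        (.prod A (.prod (.base .nat) (.base .nat))) fun p => p := .id _
    have hy : ∀ i, TotComp X M (.prod A (.prod (.base .nat) (.base .nat))) (.base .nat) (y i) := by
      intro i
      refine Fin.cases ?_ (fun i => Fin.cases ?_ (fun i => ?_) i) i
      · exact hp.snd.fst
      · exact hp.snd.snd
      · exact (hx i.succ).comp hp.fst
    refine (primRec (b := .nat) (hf (fun i => x i.succ) fun i => hx i.succ)
      (hg (A := .prod A (.prod (.base .nat) (.base .nat))) y hy) (hx 0)).of_eq
      fun a => ?_
    simp [y, List.Vector.ofFn]

theorem of_primrec {f : ℕ → ℕ} (hf : Primrec f) {A : Ty k} {x : A.El X M → ℕ}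
    (hx : TotComp X M A (.base .nat) x) : TotComp X M A (.base .nat) fun a => f (x a) :=
  (of_primrec' (Nat.Primrec'.prim_iff₁.2 hf) (fun _ => x) fun _ => hx).of_eq fun a => by simp

theorem of_primrec₂ {f : ℕ → ℕ → ℕ} (hf : Primrec₂ f) {A : Ty k} {x y : A.El X M → ℕ}
    (hx : TotComp X M A (.base .nat) x) (hy : TotComp X M A (.base .nat) y) :
    TotComp X M A (.base .nat) fun a => f (x a) (y a) :=
  (of_primrec' (Nat.Primrec'.prim_iff₂.2 hf) ![x, y] (Fin.cases hx fun i => by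
    rwa [Subsingleton.elim i 0])).of_eq fun a => by simp [List.Vector.ofFn]

end TotComp

end Total

/-- Kleene's normal form, for total functions. -/
theorem exists_primrec_normal_form {f : ℕ → ℕ} (hf : Computable f) :
    ∃ P Q : ℕ → ℕ → ℕ, Primrec₂ P ∧ Primrec₂ Q ∧
      ∀ n, ∃ m, Q n m = 0 ∧ (∀ i < m, Q n i ≠ 0) ∧ P n m = f n := by
  obtain ⟨c, hc⟩ := Nat.Partrec.Code.exists_code.1 (Partrec.nat_iff.1 hf)
  have hev : Primrec₂ fun n m : ℕ => Nat.Partrec.Code.evaln m c n :=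
    Nat.Partrec.Code.primrec_evaln.comp
      ((Primrec.snd.pair (Primrec.const c)).pair Primrec.fst)
  -- `m` bounds the running time: `Q` vanishes once the code has halted, and `P` reads off the
  -- result.
  refine ⟨fun n m => (Nat.Partrec.Code.evaln m c n).getD 0,
    fun n m => if (Nat.Partrec.Code.evaln m c n).isSome then 0 else 1,
    Primrec.option_getD.comp hev (Primrec.const 0),
    (Primrec.cond (Primrec.option_isSome.comp hev) (Primrec.const 0) (Primrec.const 1)).of_eq
      fun p => by cases h : (Nat.Partrec.Code.evaln p.2 c p.1).isSome <;> simp [h], fun n => ?_⟩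
  have hfn : f n ∈ c.eval n := by rw [hc]; exact Part.mem_some _
  have hex : ∃ m, (Nat.Partrec.Code.evaln m c n).isSome := by
    obtain ⟨m, hm⟩ := Nat.Partrec.Code.evaln_complete.1 hfn
    exact ⟨m, Option.isSome_iff_exists.2 ⟨_, hm⟩⟩
  refine ⟨Nat.find hex, by simp [Nat.find_spec hex],
    fun i hi => by simpa using Nat.find_min hex hi, ?_⟩
  obtain ⟨v, hv⟩ := Option.isSome_iff_exists.1 (Nat.find_spec hex)
  have := Part.mem_unique (Nat.Partrec.Code.evaln_sound hv) hfn
  simp [hv, this]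

namespace TotComp

variable {X : ComputableMetricSpace} {k : ℕ} {M : Fin k → ComputableBanachSpace}

/-- By the normal form, a single application of μ-recursion to a primitive recursive test is enough.
-/
theorem of_computable {f : ℕ → ℕ} (hf : Computable f) {A : Ty k} {x : A.El X M → ℕ}
    (hx : TotComp X M A (.base .nat) x) : TotComp X M A (.base .nat) fun a => f (x a) := by
  obtain ⟨P, Q, hP, hQ, hPQ⟩ := exists_primrec_normal_form hf
  choose μ hμ0 hμlt hμP using hPQ
  have hp : TotComp X M (.prod A (.base .nat)) (.prod A (.base .nat)) fun p => p := .id _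
  have hxp : TotComp X M (.prod A (.base .nat)) (.base .nat)
      fun p : A.El X M × ℕ => x p.1 :=
    hx.comp hp.fst
  have hμ : TotComp X M A (.base .nat) fun a => μ (x a) := by
    refine InternallyComputable.muRec (of_primrec₂ hQ hxp hp.snd) fun a n => ?_
    simp only [mem_tot, exists_eq_right]
    refine ⟨fun e => e ▸ ⟨(hμ0 _).symm, hμlt _⟩, fun h => ?_⟩
    rcases lt_trichotomy n (μ (x a)) with hl | hl | hl
    · exact absurd h.1.symm (hμlt _ _ hl)
    · exact hl
    · exact absurd (hμ0 _) (h.2 _ hl)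
  exact (of_primrec₂ hP hx hμ).of_eq fun a => hμP _

theorem of_computable₂ {f : ℕ → ℕ → ℕ} (hf : Computable₂ f) {A : Ty k} {x y : A.El X M → ℕ}
    (hx : TotComp X M A (.base .nat) x) (hy : TotComp X M A (.base .nat) y) :
    TotComp X M A (.base .nat) fun a => f (x a) (y a) := by
  have h : Computable fun n : ℕ => f n.unpair.1 n.unpair.2 :=
    hf.comp (Computable.fst.comp Computable.unpair) (Computable.snd.comp Computable.unpair)
  exact (of_computable h (of_primrec₂ Primrec₂.natPair hx hy)).of_eq fun a => by simp

/-! ### Real numbers -/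

theorem realAdd {A : Ty k} {f g : A.El X M → ℝ} (hf : TotComp X M A (.base .real) f)
    (hg : TotComp X M A (.base .real) g) : TotComp X M A (.base .real) fun a => f a + g a :=
  comp (B := .prod (.base .real) (.base .real)) (f := fun a => (f a, g a))
    InternallyComputable.realAdd (hf.pair hg)

theorem realSub {A : Ty k} {f g : A.El X M → ℝ} (hf : TotComp X M A (.base .real) f)
    (hg : TotComp X M A (.base .real) g) : TotComp X M A (.base .real) fun a => f a - g a :=
  comp (B := .prod (.base .real) (.base .real)) (f := fun a => (f a, g a))
    InternallyComputable.realSub (hf.pair hg)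

theorem realMul {A : Ty k} {f g : A.El X M → ℝ} (hf : TotComp X M A (.base .real) f)
    (hg : TotComp X M A (.base .real) g) : TotComp X M A (.base .real) fun a => f a * g a :=
  comp (B := .prod (.base .real) (.base .real)) (f := fun a => (f a, g a))
    InternallyComputable.realMul (hf.pair hg)

theorem realAbs {A : Ty k} {f : A.El X M → ℝ} (hf : TotComp X M A (.base .real) f) :
    TotComp X M A (.base .real) fun a => |f a| :=
  comp (f := f) InternallyComputable.realAbs hf

theorem realOne (A : Ty k) : TotComp X M A (.base .real) fun _ => (1 : ℝ) :=
  comp (B := .unit) (f := fun _ => ()) InternallyComputable.realOne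
    (InternallyComputable.terminal A)

theorem natCast {A : Ty k} {n : A.El X M → ℕ} (hn : TotComp X M A (.base .nat) n) :
    TotComp X M A (.base .real) fun a => (n a : ℝ) := by
  have hp : TotComp X M (.prod A (.prod (.base .nat) (.base .real)))
    (.prod A (.prod (.base .nat) (.base .real))) fun p => p := .id _
  -- The only real constant available is `1`, so the recursion starts from `1 - 1`.
  refine (primRec (b := .real) ((realOne A).realSub (realOne A))
    (hp.snd.snd.realAdd (realOne _)) hn).of_eq fun a => ?_
  induction n a with
  | zero => simp
  | succ n ih =>
    rw [Nat.cast_succ, ← ih]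

end TotComp

/-! ## Computability of bounded quantifiers and searches -/

section Computability

variable {α : Type} [Primcodable α]

theorem computable_find {p : α → ℕ → Bool} (hp : Computable₂ p) (h : ∀ a, ∃ n, p a n = true) :
    Computable fun a => Nat.find (h a) := by
  refine Partrec.of_eq_tot (Partrec.rfind hp.partrec₂) fun a => ?_
  refine Nat.mem_rfind.2 ⟨?_, fun {m} hm => ?_⟩
  · exact Part.mem_some_iff.2 (Nat.find_spec (h a)).symm
  · exact Part.mem_some_iff.2 (by simpa using Nat.find_min (h a) hm)

/-- The bounded universal quantifier. -/
def allBelow (n : ℕ) (p : ℕ → Bool) : Bool :=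
  Nat.rec true (fun i b => p i && b) n

theorem allBelow_iff {n : ℕ} {p : ℕ → Bool} : allBelow n p = true ↔ ∀ i < n, p i = true := by
  induction n with
  | zero => simp [allBelow]
  | succ n ih =>
    change (p n && allBelow n p) = true ↔ _
    rw [Bool.and_eq_true, ih, Nat.forall_lt_succ_right]
    exact and_comm

theorem not_allBelow_not_iff {n : ℕ} {p : ℕ → Bool} :
    (!allBelow n fun i => !p i) = true ↔ ∃ i < n, p i = true := by
  rw [Bool.not_eq_true', ← Bool.not_eq_true, allBelow_iff]
  simp

theorem computable_and {f g : α → Bool} (hf : Computable f) (hg : Computable g) :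
    Computable fun a => f a && g a :=
  Primrec.and.to_comp.comp hf hg

theorem computable_or {f g : α → Bool} (hf : Computable f) (hg : Computable g) :
    Computable fun a => f a || g a :=
  Primrec.or.to_comp.comp hf hg

theorem computable_not {f : α → Bool} (hf : Computable f) : Computable fun a => !f a :=
  Primrec.not.to_comp.comp hf

theorem computable_allBelow {f : α → ℕ} {p : α → ℕ → Bool} (hf : Computable f)
    (hp : Computable fun x : α × ℕ => p x.1 x.2) : Computable fun a => allBelow (f a) (p a) := by
  refine Computable.nat_rec (h := fun a x => p a x.1 && x.2) hf (Computable.const true) ?_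
  exact computable_and
    (hp.comp (Computable.fst.pair (Computable.fst.comp Computable.snd)))
    (Computable.snd.comp Computable.snd)

theorem computable_le {f g : α → ℕ} (hf : Computable f) (hg : Computable g) :
    Computable fun a => decide (f a ≤ g a) :=
  (Primrec.nat_le.decide.to_comp : Computable₂ _).comp hf hg

theorem computable_addConst {f : α → ℕ} (hf : Computable f) (n : ℕ) :
    Computable fun a => f a + n :=
  Primrec.nat_add.to_comp.comp hf (Computable.const n)

theorem computable_getD {l : α → List ℕ} {i : α → ℕ} (hl : Computable l) (hi : Computable i) :
    Computable fun a => (l a).getD (i a) 0 :=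
  (Primrec.list_getD 0).to_comp.comp hl hi

end Computability

/-! ## The stages of the construction of an effective embedding -/

section Stage

variable (qU qY : ℕ × ℕ × ℕ → ℕ)

/-- At precision `s`, the points with the indices `g 0, …, g s` have the distances prescribed
by `qY`. -/
def stageInv (s : ℕ) (g : List ℕ) : Bool :=
  allBelow (s + 1) fun i => allBelow (s + 1) fun k =>
    -- Slack in units of `2 ^ (-s)`: one for each of the approximations `qU` and `qY`, and one for
    -- moving two ideal points, by half a unit each, to dense points.
    decide (qU (g.getD i 0, g.getD k 0, s) ≤ qY (i, k, s) + 3) &&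
      decide (qY (i, k, s) ≤ qU (g.getD i 0, g.getD k 0, s) + 3)

/-- `g'` is a good successor of the stage `g`: the old points are moved slightly, and the new
point is not closer to the first points of the enumeration than the old ones. -/
def stageStep (s : ℕ) (g g' : List ℕ) : Bool :=
  stageInv qU qY (s + 1) g' &&
    -- Amalgamation moves a point by 5 units of `2 ^ (-(s + 1))`; density costs a half and `qU`
    -- costs 1 more.
    (allBelow (s + 1) fun i => decide (qU (g'.getD i 0, g.getD i 0, s + 1) ≤ 7)) &&
    -- The bounded existential quantifier over `i` is written with two negations.
    allBelow (s + 1) fun n => !allBelow (s + 1) fun i =>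
      !decide (qU (g.getD i 0, n, s + 1) ≤ qU (g'.getD (s + 1) 0, n, s + 1) + 3)

variable {qU qY}

theorem computable_stageInv {α : Type} [Primcodable α] (hU : Computable qU) (hY : Computable qY)
    {s : α → ℕ} {g : α → List ℕ} (hs : Computable s) (hg : Computable g) :
    Computable fun a => stageInv qU qY (s a) (g a) := by
  have hi : Computable fun x : (α × ℕ) × ℕ => x.1.2 := Computable.snd.comp Computable.fst
  have hk : Computable fun x : (α × ℕ) × ℕ => x.2 := Computable.snd
  have ha : Computable fun x : (α × ℕ) × ℕ => x.1.1 := Computable.fst.comp Computable.fst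
  have hu : Computable fun x : (α × ℕ) × ℕ =>
      qU ((g x.1.1).getD x.1.2 0, (g x.1.1).getD x.2 0, s x.1.1) :=
    hU.comp ((computable_getD (hg.comp ha) hi).pair
      ((computable_getD (hg.comp ha) hk).pair (hs.comp ha)))
  have hy : Computable fun x : (α × ℕ) × ℕ => qY (x.1.2, x.2, s x.1.1) :=
    hY.comp (hi.pair (hk.pair (hs.comp ha)))
  exact computable_allBelow (computable_addConst hs 1)
    (computable_allBelow (computable_addConst (hs.comp Computable.fst) 1)
      (computable_and (computable_le hu (computable_addConst hy 3))
        (computable_le hy (computable_addConst hu 3))))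

theorem computable_stageStep {α : Type} [Primcodable α] (hU : Computable qU) (hY : Computable qY)
    {s : α → ℕ} {g g' : α → List ℕ} (hs : Computable s) (hg : Computable g)
    (hg' : Computable g') : Computable fun a => stageStep qU qY (s a) (g a) (g' a) := by
  have hs1 := computable_addConst hs 1
  have hi : Computable fun x : α × ℕ => x.2 := Computable.snd
  have ha : Computable fun x : α × ℕ => x.1 := Computable.fst
  have hn : Computable fun x : (α × ℕ) × ℕ => x.1.2 := Computable.snd.comp Computable.fst
  have hk : Computable fun x : (α × ℕ) × ℕ => x.2 := Computable.snd
  have hb : Computable fun x : (α × ℕ) × ℕ => x.1.1 := Computable.fst.comp Computable.fst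
  refine computable_and (computable_and (computable_stageInv hU hY hs1 hg')
    (computable_allBelow hs1 (computable_le
      (hU.comp ((computable_getD (hg'.comp ha) hi).pair
        ((computable_getD (hg.comp ha) hi).pair (hs1.comp ha)))) (Computable.const 7))))
    (computable_allBelow hs1 (computable_not (computable_allBelow (hs1.comp ha)
      (computable_not (computable_le
        (hU.comp ((computable_getD (hg.comp hb) hk).pair (hn.pair (hs1.comp hb))))
        (computable_addConst
          (hU.comp ((computable_getD (hg'.comp hb) (hs1.comp hb)).pair
            (hn.pair (hs1.comp hb)))) 3))))))

/-- All later estimates count errors in units of `2 ^ (-k)`, in which an approximation is off by at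
most 1. -/
theorem abs_two_pow_mul_sub_le_one {d : ℝ} {n k : ℕ} (h : |d - (n : ℝ) / 2 ^ k| ≤ 1 / 2 ^ k) :
    2 ^ k * d ≤ n + 1 ∧ (n : ℝ) ≤ 2 ^ k * d + 1 := by
  have h2 : (0 : ℝ) < 2 ^ k := by positivity
  rw [abs_le] at h
  have e1 : 2 ^ k * ((n : ℝ) / 2 ^ k) = n := by field_simp
  have e2 : (2 : ℝ) ^ k * (1 / 2 ^ k) = 1 := by field_simp
  constructor
  · nlinarith [mul_le_mul_of_nonneg_left h.2 h2.le]
  · nlinarith [mul_le_mul_of_nonneg_left h.1 h2.le]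

variable {V Y : Type} [MetricSpace V] [MetricSpace Y] {u : ℕ → V} {y : ℕ → Y}

theorem two_pow_mul_abs_dist_sub_le_of_stageInv
    (hqU : ∀ n m k : ℕ, |dist (u n) (u m) - (qU (n, m, k) : ℝ) / 2 ^ k| ≤ 1 / 2 ^ k)
    (hqY : ∀ n m k : ℕ, |dist (y n) (y m) - (qY (n, m, k) : ℝ) / 2 ^ k| ≤ 1 / 2 ^ k)
    {s : ℕ} {g : List ℕ} (h : stageInv qU qY s g = true) {i k : ℕ} (hi : i ≤ s) (hk : k ≤ s) :
    2 ^ s * |dist (u (g.getD i 0)) (u (g.getD k 0)) - dist (y i) (y k)| ≤ 5 := by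
  simp only [stageInv, allBelow_iff, Bool.and_eq_true, decide_eq_true_eq] at h
  obtain ⟨h1, h2⟩ := h i (by omega) k (by omega)
  have h1' : (qU (g.getD i 0, g.getD k 0, s) : ℝ) ≤ qY (i, k, s) + 3 := by exact_mod_cast h1
  have h2' : (qY (i, k, s) : ℝ) ≤ qU (g.getD i 0, g.getD k 0, s) + 3 := by exact_mod_cast h2
  have hu := abs_two_pow_mul_sub_le_one (hqU (g.getD i 0) (g.getD k 0) s)
  have hy := abs_two_pow_mul_sub_le_one (hqY i k s)
  have e : ∀ x : ℝ, (2 : ℝ) ^ s * |x| = |2 ^ s * x| := fun x => by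
    rw [abs_mul, abs_of_pos (by positivity : (0 : ℝ) < 2 ^ s)]
  rw [e, abs_le, mul_sub]
  constructor <;> linarith [hu.1, hu.2, hy.1, hy.2]

end Stage

/-- Amalgamation of a finite part of `U` with `y 0, …, y (s + 1)`, over the approximate copy
`a 0, …, a s` of `y 0, …, y s`. -/
theorem ComputableMetricSpace.IsUrysohn.exists_extension {U : ComputableMetricSpace}
    (hU : U.IsUrysohn) {Y : Type} [MetricSpace Y] {s : ℕ} (a v : ℕ → U.carrier) (y : ℕ → Y)
    {ε : ℝ} (ε0 : 0 < ε)
    (H : ∀ i ≤ s, ∀ k ≤ s, |dist (a i) (a k) - dist (y i) (y k)| ≤ 2 * ε) :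
    ∃ z : ℕ → U.carrier,
      (∀ i ≤ s + 1, ∀ k ≤ s + 1, dist (z i) (z k) = dist (y i) (y k)) ∧
      (∀ i ≤ s, dist (z i) (a i) ≤ ε) ∧
      ∀ n ≤ s, ∃ i ≤ s, dist (a i) (v n) ≤ dist (z (s + 1)) (v n) := by
  -- In the glued metric a point `x` of `U` and a point `w` of `Y` have distance `ε` plus the length
  -- of the shortest path through some pair `a p`, `y p`. Only a finite part of this space is then
  -- mapped to `U`, by the identity on the points that come from `U`.
  let _ : MetricSpace (U.carrier ⊕ Y) :=
    Metric.glueMetricApprox (fun i : Fin (s + 1) => a i) (fun i => y i) ε ε0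
      fun p q => H p (by omega) q (by omega)
  let S : Set (U.carrier ⊕ Y) :=
    Sum.inl '' (a '' Set.Iic s ∪ v '' Set.Iic s) ∪ Sum.inr '' (y '' Set.Iic (s + 1))
  have hS : S.Finite :=
    ((((Set.finite_Iic s).image a).union ((Set.finite_Iic s).image v)).image _).union
      (((Set.finite_Iic (s + 1)).image y).image _)
  have : Finite S := hS
  let A : Set S := {b | ∃ x, b.1 = Sum.inl x}
  let f : A → U.carrier := fun b => b.2.choose
  have hf : ∀ b : A, b.1.1 = Sum.inl (f b) := fun b => b.2.choose_spec
  have hiso : Isometry f := Isometry.of_dist_eq fun b c => by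
    change _ = dist b.1.1 c.1.1
    rw [hf, hf]
    rfl
  obtain ⟨g, hg, hgf⟩ := hU S A f hiso
  have hl : ∀ (x : U.carrier) (hx : Sum.inl x ∈ S), g ⟨Sum.inl x, hx⟩ = x := fun x hx => by
    have h := hgf ⟨⟨Sum.inl x, hx⟩, x, rfl⟩
    rw [h]
    exact (Sum.inl_injective (hf ⟨⟨Sum.inl x, hx⟩, x, rfl⟩)).symm
  have ha : ∀ i ≤ s, Sum.inl (a i) ∈ S := fun i hi => Or.inl ⟨_, Or.inl ⟨i, hi, rfl⟩, rfl⟩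
  have hv : ∀ i ≤ s, Sum.inl (v i) ∈ S := fun i hi => Or.inl ⟨_, Or.inr ⟨i, hi, rfl⟩, rfl⟩
  have hy : ∀ i ≤ s + 1, Sum.inr (y i) ∈ S := fun i hi => Or.inr ⟨_, ⟨i, hi, rfl⟩, rfl⟩
  let z : ℕ → U.carrier := fun i => if hi : i ≤ s + 1 then g ⟨_, hy i hi⟩ else a 0
  have hz : ∀ i (hi : i ≤ s + 1), z i = g ⟨_, hy i hi⟩ := fun i hi => dif_pos hi
  have hzx : ∀ i ≤ s + 1, ∀ x, Sum.inl x ∈ S →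
      dist (z i) x = (⨅ p : Fin (s + 1), dist x (a p) + dist (y i) (y p)) + ε := by
    intro i hi x hx
    conv_lhs => rw [← hl x hx]
    rw [hz i hi, hg.dist_eq]
    rfl
  have hbdd : ∀ (x : U.carrier) (w : Y), BddBelow
      (Set.range fun p : Fin (s + 1) => dist x (a p) + dist w (y p)) := fun x w =>
    ⟨0, Set.forall_mem_range.2 fun _ => by positivity⟩
  refine ⟨z, fun i hi k hk => ?_, fun i hi => ?_, fun n hn => ?_⟩
  · rw [hz i hi, hz k hk, hg.dist_eq]
    rfl
  · rw [hzx i (by omega) _ (ha i hi)]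
    have := ciInf_le (hbdd (a i) (y i)) (⟨i, by omega⟩ : Fin (s + 1))
    simp only [dist_self, add_zero] at this
    linarith
  -- The infimum over the finitely many gluing pairs is attained, and that path to `v n` passes
  -- through `a p`; so `a p` is at least as close to `v n` as the new point.
  · rw [hzx (s + 1) le_rfl _ (hv n hn)]
    obtain ⟨p, hp⟩ := exists_eq_ciInf_of_finite
      (f := fun p : Fin (s + 1) => dist (v n) (a p) + dist (y (s + 1)) (y p))
    refine ⟨p, by omega, ?_⟩
    rw [← hp, dist_comm]
    have := dist_nonneg (x := y (s + 1)) (y := y p)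
    linarith

section Stage

variable {U : ComputableMetricSpace} {Y : Type} [MetricSpace Y] {y : ℕ → Y}
  {qU qY : ℕ × ℕ × ℕ → ℕ}

/-- The ideal points `z` of the amalgamation are replaced by dense points within half a unit of `2 ^
(-(s + 1))`. The gluing constant is half of the discrepancy `5 / 2 ^ s` allowed by the invariant. -/
theorem exists_stageStep (hU : U.IsUrysohn)
    (hqU : ∀ n m k : ℕ, |dist (U.pt n) (U.pt m) - (qU (n, m, k) : ℝ) / 2 ^ k| ≤ 1 / 2 ^ k)
    (hqY : ∀ n m k : ℕ, |dist (y n) (y m) - (qY (n, m, k) : ℝ) / 2 ^ k| ≤ 1 / 2 ^ k)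
    {s : ℕ} {g : List ℕ} (h : stageInv qU qY s g = true) :
    ∃ g', stageStep qU qY s g g' = true := by
  have hW : (0 : ℝ) < 2 ^ (s + 1) := by positivity
  have hWε : (2 : ℝ) ^ (s + 1) * (5 / 2 ^ (s + 1)) = 5 := by field_simp
  obtain ⟨z, hz1, hz2, hz3⟩ := hU.exists_extension (s := s) (ε := 5 / 2 ^ (s + 1))
    (fun i => U.pt (g.getD i 0)) U.pt y (by positivity) fun i hi k hk => by
      have := two_pow_mul_abs_dist_sub_le_of_stageInv hqU hqY h hi hk
      have h2 : (0 : ℝ) < 2 ^ s := by positivity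
      have e : 2 * (5 / 2 ^ (s + 1)) = (5 : ℝ) / 2 ^ s := by rw [pow_succ]; field_simp
      rw [e, le_div_iff₀ h2, mul_comm]
      exact this
  have ht : ∀ i, ∃ t, dist (z i) (U.pt t) < 1 / 2 / 2 ^ (s + 1) := fun i =>
    U.dense.exists_dist_lt (z i) (by positivity)
  choose t ht using ht
  have ht' : ∀ i x, 2 ^ (s + 1) * |dist (U.pt (t i)) x - dist (z i) x| ≤ 1 / 2 := fun i x => by
    have h1 := abs_dist_sub_le (U.pt (t i)) (z i) x
    have h2 := (ht i).le
    rw [dist_comm, le_div_iff₀ hW, mul_comm] at h2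
    exact (mul_le_mul_of_nonneg_left h1 hW.le).trans h2
  have ht'' : ∀ i x, 2 ^ (s + 1) * dist (U.pt (t i)) x ≤ 2 ^ (s + 1) * dist (z i) x + 1 / 2 ∧
      2 ^ (s + 1) * dist (z i) x ≤ 2 ^ (s + 1) * dist (U.pt (t i)) x + 1 / 2 := fun i x => by
    have h1 := ht' i x
    have h2 := le_abs_self (dist (U.pt (t i)) x - dist (z i) x)
    have h3 := neg_abs_le (dist (U.pt (t i)) x - dist (z i) x)
    constructor <;> nlinarith
  have hget : ∀ i ≤ s + 1, ((List.range (s + 2)).map t).getD i 0 = t i := fun i hi => by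
    rw [List.getD_eq_getElem _ _ (by simp; omega)]
    simp
  refine ⟨(List.range (s + 2)).map t, ?_⟩
  simp only [stageStep, stageInv, Bool.and_eq_true, allBelow_iff, not_allBelow_not_iff,
    decide_eq_true_eq]
  refine ⟨⟨fun i hi k hk => ?_, fun i hi => ?_⟩, fun n hn => ?_⟩
  · rw [hget i (by omega), hget k (by omega)]
    have hu := abs_two_pow_mul_sub_le_one (hqU (t i) (t k) (s + 1))
    have hy := abs_two_pow_mul_sub_le_one (hqY i k (s + 1))
    have h1 := ht'' i (U.pt (t k))
    have h2 := ht'' k (z i)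
    rw [dist_comm _ (z i), dist_comm _ (z i), hz1 i (by omega) k (by omega)] at h2
    constructor
    · have : (qU (t i, t k, s + 1) : ℝ) ≤ (qY (i, k, s + 1) + 3 : ℕ) := by push_cast; linarith
      exact_mod_cast this
    · have : (qY (i, k, s + 1) : ℝ) ≤ (qU (t i, t k, s + 1) + 3 : ℕ) := by push_cast; linarith
      exact_mod_cast this
  · rw [hget i (by omega)]
    have hu := abs_two_pow_mul_sub_le_one (hqU (t i) (g.getD i 0) (s + 1))
    have h1 := ht'' i (U.pt (g.getD i 0))
    have h2 := mul_le_mul_of_nonneg_left (hz2 i (by omega)) hW.le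
    have : (qU (t i, g.getD i 0, s + 1) : ℝ) ≤ (7 : ℕ) := by push_cast; linarith
    exact_mod_cast this
  · rw [hget _ le_rfl]
    obtain ⟨i, hi, h1⟩ := hz3 n (by omega)
    refine ⟨i, by omega, ?_⟩
    have hu := abs_two_pow_mul_sub_le_one (hqU (g.getD i 0) n (s + 1))
    have hu' := abs_two_pow_mul_sub_le_one (hqU (t (s + 1)) n (s + 1))
    have h2 := ht'' (s + 1) (U.pt n)
    have h3 := mul_le_mul_of_nonneg_left h1 hW.le
    have : (qU (g.getD i 0, n, s + 1) : ℝ) ≤ (qU (t (s + 1), n, s + 1) + 3 : ℕ) := by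
      push_cast; linarith
    exact_mod_cast this

/-- The computable sequence of stages. -/
theorem exists_stages (hU : U.IsUrysohn) (hqUc : Computable qU) (hqYc : Computable qY)
    (hqU : ∀ n m k : ℕ, |dist (U.pt n) (U.pt m) - (qU (n, m, k) : ℝ) / 2 ^ k| ≤ 1 / 2 ^ k)
    (hqY : ∀ n m k : ℕ, |dist (y n) (y m) - (qY (n, m, k) : ℝ) / 2 ^ k| ≤ 1 / 2 ^ k) :
    ∃ G : ℕ → List ℕ, Computable G ∧ (∀ s, stageInv qU qY s (G s) = true) ∧
      ∀ s, stageStep qU qY s (G s) (G (s + 1)) = true := by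
  -- The test succeeds trivially if the invariant fails, so that the search is total on all lists.
  let p : ℕ × List ℕ → ℕ → Bool := fun a n =>
    (!stageInv qU qY a.1 a.2) || stageStep qU qY a.1 a.2 (Denumerable.ofNat (List ℕ) n)
  have hp : ∀ a, ∃ n, p a n = true := by
    rintro ⟨s, g⟩
    by_cases h : stageInv qU qY s g = true
    · obtain ⟨g', hg'⟩ := exists_stageStep hU hqU hqY h
      exact ⟨Encodable.encode g', by simp [p, hg']⟩
    · exact ⟨0, by simp [p, h]⟩
  have hpc : Computable₂ p := by
    have h1 : Computable fun x : (ℕ × List ℕ) × ℕ => x.1.1 := Computable.fst.comp Computable.fst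
    have h2 : Computable fun x : (ℕ × List ℕ) × ℕ => x.1.2 := Computable.snd.comp Computable.fst
    exact computable_or (computable_not (computable_stageInv hqUc hqYc h1 h2))
      (computable_stageStep hqUc hqYc h1 h2 ((Computable.ofNat (List ℕ)).comp Computable.snd))
  let G : ℕ → List ℕ := fun s =>
    Nat.rec [] (fun s g => Denumerable.ofNat (List ℕ) (Nat.find (hp (s, g)))) s
  have hG : ∀ s, p (s, G s) (Nat.find (hp (s, G s))) = true := fun s => Nat.find_spec (hp (s, G s))
  have hstep : ∀ s, stageInv qU qY s (G s) = true →
      stageStep qU qY s (G s) (G (s + 1)) = true := fun s hs => by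
    have hpn : ∀ n, p (s, G s) n = true →
        stageStep qU qY s (G s) (Denumerable.ofNat (List ℕ) n) = true := fun n h => by
      simpa only [p, hs, Bool.not_true, Bool.false_or] using h
    exact hpn _ (hG s)
  have hinv : ∀ s, stageInv qU qY s (G s) = true := by
    intro s
    induction s with
    -- The empty list reads as index `0` through `getD`; both distances are zero, so their
    -- approximations are at most 1.
    | zero =>
      have hu := (abs_two_pow_mul_sub_le_one (hqU 0 0 0)).2
      have hy := (abs_two_pow_mul_sub_le_one (hqY 0 0 0)).2
      simp only [dist_self, mul_zero, zero_add] at hu hy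
      have hu' : qU (0, 0, 0) ≤ 1 := by exact_mod_cast hu
      have hy' : qY (0, 0, 0) ≤ 1 := by exact_mod_cast hy
      simp only [stageInv, allBelow_iff, Bool.and_eq_true, decide_eq_true_eq]
      intro i hi k hk
      obtain rfl : i = 0 := by omega
      obtain rfl : k = 0 := by omega
      change qU (0, 0, 0) ≤ _ ∧ _ ≤ qU (0, 0, 0) + 3
      omega
    | succ s ih =>
      have h := hstep s ih
      rw [stageStep, Bool.and_eq_true, Bool.and_eq_true] at h
      exact h.1.1
  refine ⟨G, ?_, hinv, fun s => hstep s (hinv s)⟩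
  have hf : Computable fun a : ℕ × List ℕ => Denumerable.ofNat (List ℕ) (Nat.find (hp a)) :=
    (Computable.ofNat (List ℕ)).comp (computable_find hpc hp)
  exact Computable.nat_rec (h := fun _ a => Denumerable.ofNat (List ℕ) (Nat.find (hp a)))
    Computable.id (Computable.const []) (hf.comp Computable.snd)

end Stage

/-- The limits of the points of the stages. -/
theorem exists_limits_of_stages {V Y : Type} [MetricSpace V] [CompleteSpace V] [MetricSpace Y]
    {a : ℕ → ℕ → V} {u : ℕ → V} {y : ℕ → Y}
    (h1 : ∀ s, ∀ i ≤ s, 2 ^ s * dist (a (s + 1) i) (a s i) ≤ 4)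
    (h2 : ∀ s, ∀ i ≤ s, ∀ k ≤ s, 2 ^ s * |dist (a s i) (a s k) - dist (y i) (y k)| ≤ 5)
    (h3 : ∀ s, ∀ n ≤ s, ∃ i ≤ s,
      2 ^ s * dist (a s i) (u n) ≤ 2 ^ s * dist (a (s + 1) (s + 1)) (u n) + 5 / 2) :
    ∃ p : ℕ → V, (∀ i k, dist (p i) (p k) = dist (y i) (y k)) ∧
      (∀ s, ∀ i ≤ s, dist (a s i) (p i) ≤ 8 / 2 ^ s) ∧
      ∀ n N m : ℕ, n ≤ N → ∃ i ≤ N, dist (p i) (u n) ≤ dist (p m) (u n) + 32 / 2 ^ N := by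
  have hc : ∀ i t : ℕ, dist (a (i + t) i) (a (i + (t + 1)) i) ≤ 8 / 2 ^ i / 2 / 2 ^ t := by
    intro i t
    have h := h1 (i + t) i (by omega)
    have hpos : (0 : ℝ) < 2 ^ (i + t) := by positivity
    have e : (8 : ℝ) / 2 ^ i / 2 / 2 ^ t = 4 / 2 ^ (i + t) := by
      rw [pow_add]; field_simp; norm_num
    rw [e, le_div_iff₀ hpos, dist_comm, mul_comm]
    exact h
  choose p hp using fun i => cauchySeq_tendsto_of_complete (cauchySeq_of_le_geometric_two (hc i))
  have hd : ∀ s, ∀ i ≤ s, dist (a s i) (p i) ≤ 8 / 2 ^ s := by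
    intro s i hi
    obtain ⟨t, rfl⟩ := Nat.exists_eq_add_of_le hi
    have h := dist_le_of_le_geometric_two_of_tendsto (hc i) (hp i) t
    rwa [div_div, ← pow_add] at h
  have hlim : ∀ i, Tendsto (fun s => a s i) atTop (𝓝 (p i)) := fun i => by
    have h : Tendsto (fun t => a (t + i) i) atTop (𝓝 (p i)) := by
      simpa only [add_comm] using hp i
    exact (tendsto_add_atTop_iff_nat (f := fun s => a s i) i).1 h
  refine ⟨p, fun i k => ?_, hd, fun n N m hn => ?_⟩
  · have ht : Tendsto (fun s => |dist (a s i) (a s k) - dist (y i) (y k)|) atTop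
        (𝓝 |dist (p i) (p k) - dist (y i) (y k)|) :=
      (((hlim i).dist (hlim k)).sub_const _).abs
    have hz : Tendsto (fun s => |dist (a s i) (a s k) - dist (y i) (y k)|) atTop (𝓝 0) := by
      refine squeeze_zero' (Eventually.of_forall fun _ => abs_nonneg _)
        (g := fun s => 5 * (1 / 2) ^ s) ?_ ?_
      · filter_upwards [eventually_ge_atTop (max i k)] with s hs
        have h := h2 s i (by omega) k (by omega)
        have hpos : (0 : ℝ) < 2 ^ s := by positivity
        rw [one_div, inv_pow, ← div_eq_mul_inv, le_div_iff₀ hpos, mul_comm]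
        exact h
      · simpa using (tendsto_pow_atTop_nhds_zero_of_lt_one (r := (1 / 2 : ℝ)) (by norm_num)
          (by norm_num)).const_mul 5
    exact sub_eq_zero.1 (abs_eq_zero.1 (tendsto_nhds_unique ht hz))
  -- Passing from stage points to limits costs 8 and 4 units on top of the 5/2 of `h3`.
  · have key : ∀ s, ∀ n ≤ s, ∃ i ≤ s, dist (p i) (u n) ≤ dist (p (s + 1)) (u n) + 16 / 2 ^ s := by
      intro s n hn
      obtain ⟨i, hi, h⟩ := h3 s n hn
      refine ⟨i, hi, ?_⟩
      have hpos : (0 : ℝ) < 2 ^ s := by positivity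
      have d1 := hd s i hi
      have d2 := hd (s + 1) (s + 1) le_rfl
      have t1 := dist_triangle_left (p i) (u n) (a s i)
      have t2 := dist_triangle (a (s + 1) (s + 1)) (p (s + 1)) (u n)
      have h' : dist (a s i) (u n) ≤ dist (a (s + 1) (s + 1)) (u n) + 5 / 2 / 2 ^ s := by
        have e : (2 : ℝ) ^ s * (5 / 2 / 2 ^ s) = 5 / 2 := by field_simp
        refine le_of_mul_le_mul_left ?_ hpos
        rw [mul_add, e]
        exact h
      have e2 : (8 : ℝ) / 2 ^ (s + 1) = 4 / 2 ^ s := by rw [pow_succ]; field_simp; norm_num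
      have e3 : (8 : ℝ) / 2 ^ s + 5 / 2 / 2 ^ s + 4 / 2 ^ s ≤ 16 / 2 ^ s := by
        rw [← add_div, ← add_div]
        gcongr
        norm_num
      linarith
    -- Descent from `m` to an index at most `N`. One step down from `s + 1` costs `16 / 2 ^ s = 32 /
    -- 2 ^ s - 32 / 2 ^ (s + 1)`, so the errors telescope; the induction is strong because a step
    -- may skip indices.
    have main : ∀ m, N ≤ m →
        ∃ i ≤ N, dist (p i) (u n) ≤ dist (p m) (u n) + (32 / 2 ^ N - 32 / 2 ^ m) := by
      intro m
      induction m using Nat.strong_induction_on with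
      | _ m ih =>
        intro hm
        rcases hm.eq_or_lt with rfl | hlt
        · exact ⟨N, le_rfl, by simp⟩
        · obtain ⟨s, rfl⟩ : ∃ s, m = s + 1 := ⟨m - 1, by omega⟩
          obtain ⟨i, hi, h⟩ := key s n (by omega)
          have e2 : (32 : ℝ) / 2 ^ (s + 1) = 16 / 2 ^ s := by rw [pow_succ]; field_simp; norm_num
          have e3 : (32 : ℝ) / 2 ^ s = 16 / 2 ^ s + 16 / 2 ^ s := by ring
          have mono : ∀ {b c : ℕ}, b ≤ c → (32 : ℝ) / 2 ^ c ≤ 32 / 2 ^ b := fun {b c} hbc => by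
            gcongr
            norm_num
          rcases le_total i N with hiN | hiN
          · exact ⟨i, hiN, by linarith [mono (show N ≤ s by omega)]⟩
          · obtain ⟨i', hi', h'⟩ := ih i (by omega) hiN
            exact ⟨i', hi', by linarith [mono hi]⟩
    rcases le_total m N with hm | hm
    · exact ⟨m, hm, le_add_of_nonneg_right (by positivity)⟩
    · obtain ⟨i, hi, h⟩ := main m hm
      refine ⟨i, hi, h.trans ?_⟩
      have : (0 : ℝ) < 32 / 2 ^ m := by positivity
      linarith

/-- A computable metric space embeds effectively in the Urysohn space, in such a way that a
point of the Urysohn space that is close to the image is close to the image of a point of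
the enumerated dense set that can be found effectively. -/
theorem exists_effective_embedding {U : ComputableMetricSpace} (hU : U.IsUrysohn) {Y : Type}
    [MetricSpace Y] {y : ℕ → Y} (hy : ComputableDist y) :
    ∃ (p : ℕ → U.carrier) (γ c : ℕ → ℕ → ℕ), Computable₂ γ ∧ Computable₂ c ∧
      (∀ i k, dist (p i) (p k) = dist (y i) (y k)) ∧
      (∀ i j, dist (U.pt (γ i j)) (p i) ≤ 1 / 2 ^ j) ∧
      ∀ j n m, dist (U.pt n) (p m) < 1 / 2 ^ j → dist (y (c j n)) (y m) ≤ 38 / 2 ^ j := by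
  obtain ⟨qU, hqUc, hqU⟩ := U.computableDist
  obtain ⟨qY, hqYc, hqY⟩ := hy
  obtain ⟨G, hGc, hinv, hstep⟩ := exists_stages hU hqUc hqYc hqU hqY
  simp only [stageStep, Bool.and_eq_true, allBelow_iff, not_allBelow_not_iff,
    decide_eq_true_eq] at hstep
  obtain ⟨p, hp1, hp2, hp3⟩ := exists_limits_of_stages (y := y) (u := U.pt)
    (a := fun s i => U.pt ((G s).getD i 0))
    (fun s i hi => by
      have h1 := (abs_two_pow_mul_sub_le_one
        (hqU ((G (s + 1)).getD i 0) ((G s).getD i 0) (s + 1))).1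
      have h2 : (qU ((G (s + 1)).getD i 0, (G s).getD i 0, s + 1) : ℝ) ≤ (7 : ℕ) := by
        exact_mod_cast (hstep s).1.2 i (by omega)
      rw [pow_succ, mul_right_comm] at h1
      push_cast at h2
      linarith)
    (fun s i hi k hk => two_pow_mul_abs_dist_sub_le_of_stageInv hqU hqY (hinv s) hi hk)
    (fun s n hn => by
      obtain ⟨i, hi, h⟩ := (hstep s).2 n (by omega)
      refine ⟨i, by omega, ?_⟩
      have h' : (qU ((G s).getD i 0, n, s + 1) : ℝ) ≤
          (qU ((G (s + 1)).getD (s + 1) 0, n, s + 1) + 3 : ℕ) := by exact_mod_cast h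
      have h1 := (abs_two_pow_mul_sub_le_one (hqU ((G s).getD i 0) n (s + 1))).1
      have h2 := (abs_two_pow_mul_sub_le_one (hqU ((G (s + 1)).getD (s + 1) 0) n (s + 1))).2
      rw [pow_succ, mul_right_comm] at h1 h2
      push_cast at h'
      linarith)
  -- This stage is late enough to contain point `i`, and its error is `8 / 2 ^ (i + j + 3) ≤ 1 / 2 ^
  -- j`.
  let γ : ℕ → ℕ → ℕ := fun i j => (G (i + j + 3)).getD i 0
  have hγc : Computable₂ γ :=
    computable_getD (hGc.comp (computable_addConst (Primrec.nat_add.to_comp) 3)) Computable.fst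
  have hγ : ∀ i j, dist (U.pt (γ i j)) (p i) ≤ 1 / 2 ^ j := fun i j => by
    refine (hp2 (i + j + 3) i (by omega)).trans ?_
    have e : (8 : ℝ) / 2 ^ (i + j + 3) = 1 / 2 ^ (i + j) := by rw [pow_add]; field_simp; norm_num
    rw [e]
    gcongr
    · norm_num
    · omega
  -- For `a = (j, n)` only the indices up to `j + n` matter; the first alternative merely stops the
  -- search. In units of `2 ^ (-j)`, a point almost as close to `u n` as any other is within 1 + 32,
  -- then 1 is added for `γ` and 1 for `qU`, which gives 35. Conversely 35 means a true distance of
  -- at most 36, and two more triangle inequalities give 38.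
  let t : ℕ × ℕ → ℕ → Bool := fun a i =>
    decide (a.1 + a.2 + 1 ≤ i) || decide (qU (γ i a.1, a.2, a.1) ≤ 35)
  have ht : ∀ a, ∃ i, t a i = true := fun a => ⟨a.1 + a.2 + 1, by simp [t]⟩
  have htc : Computable₂ t := by
    have h1 : Computable fun x : (ℕ × ℕ) × ℕ => x.1.1 := Computable.fst.comp Computable.fst
    have h2 : Computable fun x : (ℕ × ℕ) × ℕ => x.1.2 := Computable.snd.comp Computable.fst
    have h3 : Computable fun x : (ℕ × ℕ) × ℕ => x.2 := Computable.snd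
    exact computable_or
      (computable_le (computable_addConst (Primrec.nat_add.to_comp.comp h1 h2) 1) h3)
      (computable_le (hqUc.comp ((hγc.comp h3 h1).pair (h2.pair h1))) (Computable.const 35))
  refine ⟨p, γ, fun j n => Nat.find (ht (j, n)), hγc, computable_find htc ht, hp1, hγ,
    fun j n m h => ?_⟩
  change dist (y (Nat.find (ht (j, n)))) (y m) ≤ _
  have hpos : (0 : ℝ) < 2 ^ j := by positivity
  have scale : ∀ {d b : ℝ}, 2 ^ j * d ≤ b → d ≤ b / 2 ^ j := fun {d b} h => by
    rwa [le_div_iff₀ hpos, mul_comm]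
  obtain ⟨i, hi, hpi⟩ := hp3 n (j + n) m (by omega)
  have hle : (32 : ℝ) / 2 ^ (j + n) ≤ 32 / 2 ^ j := by
    gcongr
    · norm_num
    · omega
  have hq : qU (γ i j, n, j) ≤ 35 := by
    have h1 := (abs_two_pow_mul_sub_le_one (hqU (γ i j) n j)).2
    have h2 : dist (U.pt (γ i j)) (U.pt n) ≤ 34 / 2 ^ j := by
      have e : (34 : ℝ) / 2 ^ j = 1 / 2 ^ j + (1 / 2 ^ j + 32 / 2 ^ j) := by ring
      have t1 := dist_triangle (U.pt (γ i j)) (p i) (U.pt n)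
      rw [dist_comm (U.pt n)] at h
      linarith [hγ i j]
    rw [le_div_iff₀ hpos, mul_comm] at h2
    have : (qU (γ i j, n, j) : ℝ) ≤ (35 : ℕ) := by push_cast; linarith
    exact_mod_cast this
  have hfi : Nat.find (ht (j, n)) ≤ i := Nat.find_min' _ (by simp [t, hq])
  have hspec := Nat.find_spec (ht (j, n))
  generalize Nat.find (ht (j, n)) = l at hfi hspec ⊢
  simp only [t, Bool.or_eq_true, decide_eq_true_eq] at hspec
  have hql : qU (γ l j, n, j) ≤ 35 := hspec.resolve_left (by omega)
  have h1 := (abs_two_pow_mul_sub_le_one (hqU (γ l j) n j)).1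
  have hql' : (qU (γ l j, n, j) : ℝ) ≤ (35 : ℕ) := by exact_mod_cast hql
  push_cast at hql'
  have h2 := scale (h1.trans (show _ ≤ (36 : ℝ) by linarith))
  have t2 := dist_triangle (p l) (U.pt n) (p m)
  have t3 := dist_triangle_left (p l) (U.pt n) (U.pt (γ l j))
  have e : (38 : ℝ) / 2 ^ j = 1 / 2 ^ j + 36 / 2 ^ j + 1 / 2 ^ j := by ring
  rw [← hp1]
  linarith [hγ l j]

/-! ## Accumulation -/

section Accumulation

/-- The partial sums of `f`, cut off at `1`. -/
def cutSum (f : ℕ → ℝ) (n : ℕ) : ℝ := min 1 (∑ i ∈ Finset.range n, f i)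

/-- The coefficients of the accumulation operator. -/
def accumWeight (f : ℕ → ℝ) (i : ℕ) : ℝ := cutSum f (i + 1) - cutSum f i

open Classical in
/-- The accumulation operator, as a total function. -/
noncomputable def accum {E : Type} [NormedAddCommGroup E] [NormedSpace ℝ E]
    (f : ℕ → ℝ) (g : ℕ → E) : E :=
  if h : ∃ N, 1 < ∑ i ∈ Finset.range N, f i then
    ∑ i ∈ Finset.range (Nat.find h), accumWeight f i • g i
  else 0

variable {E : Type} [NormedAddCommGroup E] [NormedSpace ℝ E] {f : ℕ → ℝ} {g : ℕ → E}

theorem sum_range_mono (hf : ∀ i, 0 ≤ f i) : Monotone fun n => ∑ i ∈ Finset.range n, f i :=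
  fun _ _ h => Finset.sum_le_sum_of_subset_of_nonneg (Finset.range_mono h) fun i _ _ => hf i

theorem accumWeight_nonneg (hf : ∀ i, 0 ≤ f i) (i : ℕ) : 0 ≤ accumWeight f i :=
  sub_nonneg.2 (min_le_min_left _ (sum_range_mono hf i.le_succ))

theorem pos_of_accumWeight_pos (hf : ∀ i, 0 ≤ f i) {i : ℕ} (h : 0 < accumWeight f i) :
    0 < f i := by
  refine (hf i).lt_of_ne fun e => h.ne' ?_
  rw [accumWeight, cutSum, cutSum, Finset.sum_range_succ, ← e, add_zero, sub_self]

theorem accumWeight_eq_zero (hf : ∀ i, 0 ≤ f i) {N i : ℕ}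
    (hN : 1 < ∑ i ∈ Finset.range N, f i) (hi : N ≤ i) : accumWeight f i = 0 := by
  have h1 := hN.le.trans (sum_range_mono hf hi)
  have h2 := hN.le.trans (sum_range_mono hf (hi.trans i.le_succ))
  rw [accumWeight, cutSum, cutSum, min_eq_left h1, min_eq_left h2, sub_self]

theorem sum_accumWeight {N : ℕ} (hN : 1 < ∑ i ∈ Finset.range N, f i) :
    ∑ i ∈ Finset.range N, accumWeight f i = 1 := by
  simp only [accumWeight]
  rw [Finset.sum_range_sub, cutSum, cutSum, min_eq_left hN.le]
  simp

/-- The weights vanish beyond the threshold, so any `N` past it may be used. This freedom is what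
gives continuity. -/
theorem accum_eq_sum (hf : ∀ i, 0 ≤ f i) {N : ℕ} (hN : 1 < ∑ i ∈ Finset.range N, f i) :
    accum f g = ∑ i ∈ Finset.range N, accumWeight f i • g i := by
  classical
  have h : ∃ N, 1 < ∑ i ∈ Finset.range N, f i := ⟨N, hN⟩
  rw [accum, dif_pos h]
  refine Finset.sum_subset (Finset.range_mono (Nat.find_min' h hN)) fun i _ hi => ?_
  rw [accumWeight_eq_zero hf (Nat.find_spec h) (by simpa using hi), zero_smul]

/-- Before the crossing index the increments of the truncated sums are the `f i`, and at that index
the increment is the remainder up to 1. -/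
theorem isAccum_iff (hf : ∀ i, 0 ≤ f i) (h : ∃ N, 1 < ∑ i ∈ Finset.range N, f i) {v : E} :
    IsAccum f g v ↔ v = accum f g := by
  have key : ∀ n, ∑ i ∈ Finset.range n, f i ≤ 1 → 1 < ∑ i ∈ Finset.range (n + 1), f i →
      ∑ i ∈ Finset.range n, f i • g i + (1 - ∑ i ∈ Finset.range n, f i) • g n = accum f g := by
    intro n h1 h2
    rw [accum_eq_sum hf h2, Finset.sum_range_succ]
    congr 1
    · refine Finset.sum_congr rfl fun i hi => ?_
      have hi' : i + 1 ≤ n := by simpa using hi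
      have e1 := (sum_range_mono hf hi').trans h1
      have e2 := (sum_range_mono hf i.le_succ).trans e1
      rw [accumWeight, cutSum, cutSum, min_eq_right e1, min_eq_right e2]
      simp only [Finset.sum_range_succ, add_sub_cancel_left]
    · rw [accumWeight, cutSum, cutSum, min_eq_left h2.le, min_eq_right h1]
  constructor
  · rintro ⟨_, n, h1, h2, rfl⟩
    exact key n h1 h2
  · rintro rfl
    classical
    obtain ⟨n, hn⟩ : ∃ n, Nat.find h = n + 1 := Nat.exists_eq_succ_of_ne_zero fun h0 => by
      have := Nat.find_spec h
      rw [h0] at this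
      norm_num at this
    have h1 : ∑ i ∈ Finset.range n, f i ≤ 1 := not_lt.1 (Nat.find_min h (by omega))
    have h2 := Nat.find_spec h
    rw [hn] at h2
    exact ⟨hf, n, h1, h2, (key n h1 h2).symm⟩

/-- The accumulated value is a convex combination of those `g i` with `0 < f i`. -/
theorem norm_accum_sub_le (hf : ∀ i, 0 ≤ f i) (h : ∃ N, 1 < ∑ i ∈ Finset.range N, f i) {x : E}
    {δ : ℝ} (hg : ∀ i, 0 < f i → ‖g i - x‖ ≤ δ) : ‖accum f g - x‖ ≤ δ := by
  obtain ⟨N, hN⟩ := h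
  have e : accum f g - x = ∑ i ∈ Finset.range N, accumWeight f i • (g i - x) := by
    simp only [smul_sub]
    rw [Finset.sum_sub_distrib, ← Finset.sum_smul, sum_accumWeight hN, one_smul,
      accum_eq_sum hf hN]
  rw [e]
  refine (norm_sum_le _ _).trans ?_
  have : ∀ i ∈ Finset.range N, ‖accumWeight f i • (g i - x)‖ ≤ accumWeight f i * δ := by
    intro i _
    rw [norm_smul, Real.norm_of_nonneg (accumWeight_nonneg hf i)]
    rcases (accumWeight_nonneg hf i).eq_or_lt with h0 | h0
    · rw [← h0, zero_mul, zero_mul]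
    · exact mul_le_mul_of_nonneg_left (hg i (pos_of_accumWeight_pos hf h0)) h0.le
  refine (Finset.sum_le_sum this).trans ?_
  rw [← Finset.sum_mul, sum_accumWeight hN, one_mul]

/-- Exceeding 1 is an open condition, so near a given point one `N` serves and the sum is finite
with continuous weights. -/
theorem continuous_accum {Z : Type} [TopologicalSpace Z] {f : ℕ → Z → ℝ}
    (hc : ∀ i, Continuous (f i))
    (hf : ∀ z i, 0 ≤ f i z) (h : ∀ z, ∃ N, 1 < ∑ i ∈ Finset.range N, f i z) (g : ℕ → E) :
    Continuous fun z => accum (fun i => f i z) g := by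
  refine continuous_iff_continuousAt.2 fun z => ?_
  obtain ⟨N, hN⟩ := h z
  have hs : ∀ n, Continuous fun z => ∑ i ∈ Finset.range n, f i z := fun n =>
    continuous_finsetSum _ fun i _ => hc i
  have hw : Continuous fun z => ∑ i ∈ Finset.range N, accumWeight (fun i => f i z) i • g i :=
    continuous_finsetSum _ fun i _ =>
      ((continuous_const.min (hs (i + 1))).sub (continuous_const.min (hs i))).smul continuous_const
  refine hw.continuousAt.congr ?_
  filter_upwards [(hs N).continuousAt.eventually (lt_mem_nhds hN)] with z' hz'
  exact (accum_eq_sum (hf z') hz').symm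

/-- Accumulation of point masses is a probability distribution. -/
theorem hasSum_accum_indicator (hf : ∀ i, 0 ≤ f i) (h : ∃ N, 1 < ∑ i ∈ Finset.range N, f i)
    (γ : ℕ → ℕ) : HasSum (fun n => accum f fun i => if γ i = n then (1 : ℝ) else 0) 1 := by
  obtain ⟨N, hN⟩ := h
  simp only [accum_eq_sum hf hN, smul_eq_mul, mul_ite, mul_one, mul_zero]
  rw [← sum_accumWeight hN]
  exact hasSum_sum fun i _ => by simpa only [eq_comm] using hasSum_ite_eq (γ i) (accumWeight f i)

theorem accum_indicator_nonneg (hf : ∀ i, 0 ≤ f i) (h : ∃ N, 1 < ∑ i ∈ Finset.range N, f i)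
    (γ : ℕ → ℕ) (n : ℕ) : 0 ≤ accum f fun i => if γ i = n then (1 : ℝ) else 0 := by
  obtain ⟨N, hN⟩ := h
  rw [accum_eq_sum hf hN]
  refine Finset.sum_nonneg fun i _ => mul_nonneg (accumWeight_nonneg hf i) ?_
  split_ifs <;> norm_num

theorem exists_of_accum_indicator_pos (hf : ∀ i, 0 ≤ f i)
    (h : ∃ N, 1 < ∑ i ∈ Finset.range N, f i) {γ : ℕ → ℕ} {n : ℕ}
    (hn : 0 < accum f fun i => if γ i = n then (1 : ℝ) else 0) : ∃ i, 0 < f i ∧ γ i = n := by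
  obtain ⟨N, hN⟩ := h
  rw [accum_eq_sum hf hN] at hn
  obtain ⟨i, _, hi⟩ := Finset.exists_lt_of_sum_lt (f := fun _ => (0 : ℝ)) (by simpa using hn)
  by_cases e : γ i = n
  · exact ⟨i, pos_of_accumWeight_pos hf (by simpa [e] using hi), e⟩
  · simp [e] at hi

/-- A function that is concentrated on the reals below `1 / 2 ^ J`. -/
def bump (J : ℕ) (d : ℝ) : ℝ := (1 - 2 ^ J * d) + |1 - 2 ^ J * d|

theorem bump_nonneg (J : ℕ) (d : ℝ) : 0 ≤ bump J d := by
  have := neg_abs_le (1 - 2 ^ J * d)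
  rw [bump]
  linarith

theorem bump_pos_iff {J : ℕ} {d : ℝ} : 0 < bump J d ↔ d < 1 / 2 ^ J := by
  rw [lt_div_iff₀ (by positivity : (0 : ℝ) < 2 ^ J), mul_comm, bump]
  constructor
  · intro h
    by_contra hn
    rw [abs_of_nonpos (by linarith)] at h
    linarith
  · intro h
    linarith [abs_nonneg (1 - 2 ^ J * d)]

theorem continuous_bump (J : ℕ) : Continuous (bump J) := by
  unfold bump
  fun_prop

/-- If every point is repeated infinitely often, the bumps add up to infinity. -/
theorem exists_one_lt_sum_bump {V : Type} [MetricSpace V] {s : ℕ → V} (hs : DenseRange s) (J : ℕ)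
    (x : V) : ∃ N, 1 < ∑ i ∈ Finset.range N, bump J (dist x (s i.unpair.1)) := by
  obtain ⟨m, hm⟩ := hs.exists_dist_lt x (by positivity : (0 : ℝ) < 1 / 2 ^ J)
  have hpos := bump_pos_iff.2 hm
  obtain ⟨B, hB⟩ := exists_nat_gt (1 / bump J (dist x (s m)))
  -- The indices `Nat.pair m b` with `b < B` all name `s m`, and they contribute `B` times its
  -- positive bump.
  refine ⟨Nat.pair m B, ?_⟩
  have hinj : Function.Injective (Nat.pair m) := fun a b h => (Nat.pair_eq_pair.1 h).2
  have hsub : (Finset.range B).image (Nat.pair m) ⊆ Finset.range (Nat.pair m B) := by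
    intro i hi
    obtain ⟨b, hb, rfl⟩ := Finset.mem_image.1 hi
    exact Finset.mem_range.2 (Nat.pair_lt_pair_right m (Finset.mem_range.1 hb))
  refine lt_of_lt_of_le ?_ (Finset.sum_le_sum_of_subset_of_nonneg hsub fun i _ _ => bump_nonneg _ _)
  rw [Finset.sum_image hinj.injOn]
  simpa using (div_lt_iff₀ hpos).1 hB

end Accumulation

/-! ## Modified limits -/

section ModifiedLimit

variable {E : Type} [NormedAddCommGroup E] [NormedSpace ℝ E]

/-- The radial retraction to the ball of radius `a`. -/
noncomputable def clip (a : ℝ) (v : E) : E := (if ‖v‖ ≤ a then (1 : ℝ) else a / ‖v‖) • v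

theorem norm_clip_le {a : ℝ} (ha : 0 < a) (v : E) : ‖clip a v‖ ≤ a := by
  rw [clip]
  split_ifs with h
  · simpa using h
  · have hv : 0 < ‖v‖ := ha.trans (not_le.1 h)
    rw [norm_smul, Real.norm_of_nonneg (by positivity), div_mul_cancel₀ _ hv.ne']

theorem continuous_clip {a : ℝ} (ha : 0 < a) : Continuous (clip a : E → E) := by
  have e : (clip a : E → E) = fun v => (a / max a ‖v‖) • v := by
    funext v
    rw [clip]
    split_ifs with h
    · rw [max_eq_left h, div_self ha.ne']
    · rw [max_eq_right (not_le.1 h).le]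
  rw [e]
  exact (continuous_const.div (continuous_const.max continuous_norm)
    fun v => (ha.trans_le (le_max_left _ _)).ne').smul continuous_id

theorem dist_modSeq_succ_le (w : ℕ → E) (j : ℕ) :
    dist (modSeq w j) (modSeq w (j + 1)) ≤ 2 / 2 / 2 ^ j := by
  rw [dist_eq_norm', div_self two_ne_zero]
  change ‖modSeq w j + clip (1 / 2 ^ j) _ - modSeq w j‖ ≤ _
  rw [add_sub_cancel_left]
  exact norm_clip_le (by positivity) _

/-- The modified limit. -/
noncomputable def modLim (w : ℕ → E) : E := limUnder atTop (modSeq w)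

theorem tendsto_modSeq [CompleteSpace E] (w : ℕ → E) :
    Tendsto (modSeq w) atTop (𝓝 (modLim w)) :=
  (cauchySeq_of_le_geometric_two (dist_modSeq_succ_le w)).tendsto_limUnder

theorem isModLim_iff [CompleteSpace E] {w : ℕ → E} {v : E} : IsModLim w v ↔ v = modLim w :=
  ⟨fun h => tendsto_nhds_unique h (tendsto_modSeq w), fun h => h ▸ tendsto_modSeq w⟩

/-- Step `j` has length at most `1 / 2 ^ j` whatever the parameter, so the limit is uniform. -/
theorem continuous_modLim [CompleteSpace E] {Z : Type} [TopologicalSpace Z] {w : Z → ℕ → E}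
    (hw : ∀ j, Continuous fun z => w z j) : Continuous fun z => modLim (w z) := by
  have hc : ∀ j, Continuous fun z => modSeq (w z) j := by
    intro j
    induction j with
    | zero => exact hw 0
    | succ j ih =>
      exact ih.add ((continuous_clip (by positivity : (0 : ℝ) < 1 / 2 ^ j)).comp
        ((hw (j + 1)).sub ih))
  refine TendstoUniformly.continuous (F := fun j z => modSeq (w z) j) (p := atTop) ?_
    (Eventually.of_forall hc).frequently
  rw [Metric.tendstoUniformly_iff]
  intro ε hε
  have h2 : Tendsto (fun j : ℕ => (2 : ℝ) * (1 / 2) ^ j) atTop (𝓝 0) := by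
    simpa using (tendsto_pow_atTop_nhds_zero_of_lt_one (r := (1 / 2 : ℝ)) (by norm_num)
      (by norm_num)).const_mul 2
  filter_upwards [h2.eventually (gt_mem_nhds hε)] with j hj z
  rw [dist_comm]
  refine (dist_le_of_le_geometric_two_of_tendsto (dist_modSeq_succ_le (w z))
    (tendsto_modSeq (w z)) j).trans_lt ?_
  simpa [div_eq_mul_inv] using hj

/-- Consecutive terms are within `1 / 2 ^ j`, so the sequence is not modified. -/
theorem modLim_eq [CompleteSpace E] {w : ℕ → E} {x : E}
    (h : ∀ j, ‖w j - x‖ ≤ 1 / 2 ^ (j + 1)) : modLim w = x := by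
  have hstep : ∀ j, ‖w (j + 1) - w j‖ ≤ 1 / 2 ^ j := fun j => by
    have e : w (j + 1) - w j = (w (j + 1) - x) - (w j - x) := by abel
    have h1 : (1 : ℝ) / 2 ^ (j + 1 + 1) ≤ 1 / 2 ^ (j + 1) := by
      gcongr
      · norm_num
      · omega
    have h2 : (1 : ℝ) / 2 ^ (j + 1) + 1 / 2 ^ (j + 1) = 1 / 2 ^ j := by
      rw [pow_succ]; field_simp; norm_num
    rw [e]
    linarith [norm_sub_le (w (j + 1) - x) (w j - x), h j, h (j + 1)]
  have hmod : modSeq w = w := by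
    funext j
    induction j with
    | zero => rfl
    | succ j ih =>
      rw [modSeq, ih, if_pos (hstep j), one_smul, add_sub_cancel]
  refine (isModLim_iff.1 ?_).symm
  rw [IsModLim, hmod, tendsto_iff_norm_sub_tendsto_zero]
  refine squeeze_zero (fun _ => norm_nonneg _) (g := fun j => (1 / 2) ^ j) (fun j => ?_)
    (tendsto_pow_atTop_nhds_zero_of_lt_one (by norm_num) (by norm_num))
  refine (h j).trans ?_
  rw [div_pow, one_pow]
  gcongr
  · norm_num
  · omega

end ModifiedLimit

/-- An isometry on an enumerated dense subset extends. -/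
theorem exists_isometry_extension {Y V : Type} [MetricSpace Y] [MetricSpace V] [CompleteSpace V]
    {y : ℕ → Y} (hy : DenseRange y) {p : ℕ → V}
    (hp : ∀ i k, dist (p i) (p k) = dist (y i) (y k)) :
    ∃ f : Y → V, Isometry f ∧ ∀ i, f (y i) = p i := by
  have hseq : ∀ x, ∃ m : ℕ → ℕ, Tendsto (fun n => y (m n)) atTop (𝓝 x) := fun x => by
    obtain ⟨z, hz, ht⟩ := mem_closure_iff_seq_limit.1 (hy x)
    choose m hm using hz
    exact ⟨m, by simpa only [hm] using ht⟩
  choose m hm using hseq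
  have hc : ∀ x, CauchySeq fun n => p (m x n) := fun x => by
    have h := (hm x).cauchySeq
    rw [Metric.cauchySeq_iff] at h ⊢
    simpa only [hp] using h
  choose f hf using fun x => cauchySeq_tendsto_of_complete (hc x)
  refine ⟨f, Isometry.of_dist_eq fun a b => ?_, fun i => ?_⟩
  · have h := (hf a).dist (hf b)
    simp only [hp] at h
    exact tendsto_nhds_unique h ((hm a).dist (hm b))
  · have h := (hf (y i)).dist (tendsto_const_nhds (x := p i))
    simp only [hp] at h
    have h' := tendsto_nhds_unique h ((hm (y i)).dist (tendsto_const_nhds (x := y i)))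
    rwa [dist_self, dist_eq_zero] at h'

/-! ## Internal computability of the derived operators -/

namespace TotComp

variable {X : ComputableMetricSpace} {k : ℕ} {M : Fin k → ComputableBanachSpace}

theorem metPt {A : Ty k} {n : A.El X M → ℕ} (hn : TotComp X M A (.base .nat) n) :
    TotComp X M A (.base .met) fun a => X.pt (n a) :=
  comp (f := n) InternallyComputable.metPt hn

theorem metDist {A : Ty k} {f g : A.El X M → X.carrier} (hf : TotComp X M A (.base .met) f)
    (hg : TotComp X M A (.base .met) g) :
    TotComp X M A (.base .real) fun a => dist (f a) (g a) :=
  comp (B := .prod (.base .met) (.base .met)) (f := fun a => (f a, g a))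
    InternallyComputable.metDist (hf.pair hg)

theorem banPt {A : Ty k} (i : Fin k) {n : A.El X M → ℕ} (hn : TotComp X M A (.base .nat) n) :
    TotComp X M A (.base (.ban i)) fun a => (M i).pt (n a) :=
  comp (f := n) (InternallyComputable.banPt i) hn

theorem banAdd {A : Ty k} (i : Fin k) {f g : A.El X M → (M i).carrier}
    (hf : TotComp X M A (.base (.ban i)) f) (hg : TotComp X M A (.base (.ban i)) g) :
    TotComp X M A (.base (.ban i)) fun a => f a + g a :=
  comp (B := .prod (.base (.ban i)) (.base (.ban i))) (f := fun a => (f a, g a))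
    (InternallyComputable.banAdd i) (hf.pair hg)

theorem banSmul {A : Ty k} (i : Fin k) {c : A.El X M → ℝ} {f : A.El X M → (M i).carrier}
    (hc : TotComp X M A (.base .real) c) (hf : TotComp X M A (.base (.ban i)) f) :
    TotComp X M A (.base (.ban i)) fun a => c a • f a :=
  comp (B := .prod (.base .real) (.base (.ban i))) (f := fun a => (c a, f a))
    (InternallyComputable.banSmul i) (hc.pair hf)

theorem banNorm {A : Ty k} (i : Fin k) {f : A.El X M → (M i).carrier}
    (hf : TotComp X M A (.base (.ban i)) f) : TotComp X M A (.base .real) fun a => ‖f a‖ :=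
  comp (f := f) (InternallyComputable.banNorm i) hf

theorem banDist {A : Ty k} (i : Fin k) {f g : A.El X M → (M i).carrier}
    (hf : TotComp X M A (.base (.ban i)) f) (hg : TotComp X M A (.base (.ban i)) g) :
    TotComp X M A (.base .real) fun a => dist (f a) (g a) := by
  have hneg : TotComp X M A (.base .real) fun _ => ((1 : ℝ) - 1) - 1 :=
    ((realOne A).realSub (realOne A)).realSub (realOne A)
  refine (banNorm i (banAdd i hf (banSmul i hneg hg))).of_eq fun a => ?_
  rw [sub_self, zero_sub, neg_smul, one_smul, ← sub_eq_add_neg, dist_eq_norm]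

theorem bump {A : Ty k} {J : A.El X M → ℕ} {d : A.El X M → ℝ}
    (hJ : TotComp X M A (.base .nat) J) (hd : TotComp X M A (.base .real) d) :
    TotComp X M A (.base .real) fun a => bump (J a) (d a) := by
  have hpow : Primrec fun n : ℕ => 2 ^ n :=
    (Primrec₂.unpaired'.1 Nat.Primrec.pow).comp (Primrec.const 2) Primrec.id
  have ht : TotComp X M A (.base .real) fun a => 1 - 2 ^ J a * d a :=
    ((realOne A).realSub ((natCast (of_primrec hpow hJ)).realMul hd)).of_eq fun a => by
      rw [Nat.cast_pow, Nat.cast_ofNat]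
  exact ht.realAdd ht.realAbs

theorem indicator {A : Ty k} {m n : A.El X M → ℕ} (hm : TotComp X M A (.base .nat) m)
    (hn : TotComp X M A (.base .nat) n) :
    TotComp X M A (.base .real) fun a => if m a = n a then (1 : ℝ) else 0 := by
  have h : Primrec₂ fun m n : ℕ => if m = n then 1 else 0 :=
    Primrec.ite Primrec.eq (Primrec.const 1) (Primrec.const 0)
  exact (natCast (of_primrec₂ h hm hn)).of_eq fun a => by split_ifs <;> simp

theorem unpairFst {A : Ty k} {n : A.El X M → ℕ} (hn : TotComp X M A (.base .nat) n) :
    TotComp X M A (.base .nat) fun a => (n a).unpair.1 :=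
  of_primrec (Primrec.fst.comp Primrec.unpair) hn

/-- Nonnegativity and partial sums exceeding 1 make the partial operator total, with value `accum`.
-/
theorem realAccum {A : Ty k} {f g : A.El X M × ℕ → ℝ}
    (hf : TotComp X M (.prod A (.base .nat)) (.base .real) f)
    (hg : TotComp X M (.prod A (.base .nat)) (.base .real) g) (h0 : ∀ a i, 0 ≤ f (a, i))
    (h1 : ∀ a, ∃ N, 1 < ∑ i ∈ Finset.range N, f (a, i)) :
    TotComp X M A (.base .real) fun a => accum (fun i => f (a, i)) fun i => g (a, i) := by
  refine InternallyComputable.realAccum hf hg fun a v => ?_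
  rw [mem_tot, ← isAccum_iff (h0 a) (h1 a)]
  refine ⟨fun h => ⟨_, _, fun _ => mem_tot.2 rfl, fun _ => mem_tot.2 rfl, h⟩, ?_⟩
  rintro ⟨f', g', hf', hg', h⟩
  rwa [← funext fun n => mem_tot.1 (hf' n), ← funext fun n => mem_tot.1 (hg' n)]

theorem banAccum {A : Ty k} (i : Fin k) {f : A.El X M × ℕ → ℝ}
    {g : A.El X M × ℕ → (M i).carrier}
    (hf : TotComp X M (.prod A (.base .nat)) (.base .real) f)
    (hg : TotComp X M (.prod A (.base .nat)) (.base (.ban i)) g) (h0 : ∀ a i, 0 ≤ f (a, i))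
    (h1 : ∀ a, ∃ N, 1 < ∑ i ∈ Finset.range N, f (a, i)) :
    TotComp X M A (.base (.ban i)) fun a => accum (fun i => f (a, i)) fun i => g (a, i) := by
  refine InternallyComputable.banAccum i hf hg fun a v => ?_
  rw [mem_tot, ← isAccum_iff (h0 a) (h1 a)]
  refine ⟨fun h => ⟨_, _, fun _ => mem_tot.2 rfl, fun _ => mem_tot.2 rfl, h⟩, ?_⟩
  rintro ⟨f', g', hf', hg', h⟩
  rwa [← funext fun n => mem_tot.1 (hf' n), ← funext fun n => mem_tot.1 (hg' n)]

theorem banModLim {A : Ty k} (i : Fin k) {w : A.El X M × ℕ → (M i).carrier}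
    (hw : TotComp X M (.prod A (.base .nat)) (.base (.ban i)) w) :
    TotComp X M A (.base (.ban i)) fun a => modLim fun n => w (a, n) := by
  refine InternallyComputable.banModLim i hw fun a v => ?_
  rw [mem_tot, ← isModLim_iff]
  refine ⟨fun h => ⟨_, fun _ => mem_tot.2 rfl, h⟩, ?_⟩
  rintro ⟨w', hw', h⟩
  rwa [← funext fun n => mem_tot.1 (hw' n)]

theorem metDistLim {A : Ty k} {μ : A.El X M × (ℕ × ℕ) → ℝ} {h : A.El X M → X.carrier}
    (hμ : TotComp X M (.prod A (.prod (.base .nat) (.base .nat))) (.base .real) μ)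
    (hh : ∀ a, IsDistLim X.pt (fun j n => μ (a, (j, n))) (h a)) :
    TotComp X M A (.base .met) h := by
  refine InternallyComputable.metDistLim hμ fun a x => ?_
  rw [mem_tot]
  refine ⟨fun e => ⟨_, fun _ _ => mem_tot.2 rfl, e ▸ hh a⟩, ?_⟩
  rintro ⟨μ', hμ', h'⟩
  obtain rfl : μ' = fun j n => μ (a, (j, n)) := funext₂ fun j n => mem_tot.1 (hμ' j n)
  -- A distribution of total mass 1 charges some point, so there is a selection `γ`; its limit is
  -- unique.
  have hpos : ∀ j, ∃ n, 0 < μ (a, (j, n)) := fun j => by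
    by_contra! hn
    have h0 : (fun n => μ (a, (j, n))) = fun _ => 0 :=
      funext fun n => le_antisymm (hn n) ((h'.1 j).1 n)
    have hs := (h'.1 j).2
    simp only [h0] at hs
    exact zero_ne_one (hasSum_zero.unique hs)
  choose γ hγ using hpos
  exact tendsto_nhds_unique (h'.2 γ hγ).2 ((hh a).2 γ hγ).2

end TotComp

/-! ## The retractions -/

section Retraction

variable {k : ℕ} (M : Fin k → ComputableBanachSpace) {U : ComputableMetricSpace}

/-- A point charged at level `j` is a `2 ^ (-(j + 2))`-approximation to the image of some `y i` that
is equally close to `x`. It is thus within `2 ^ (-(j + 1))` of `e x`, which leaves `2 ^ (-j)`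
between consecutive choices. -/
theorem isDistLim_accum {Y V : Type} [MetricSpace Y] [MetricSpace V] {y : ℕ → Y}
    (hy : DenseRange y) {s : ℕ → V} {e : Y → V} (he : Isometry e) {γ : ℕ → ℕ → ℕ}
    (hγ : ∀ i j, dist (s (γ i j)) (e (y i)) ≤ 1 / 2 ^ j) (x : Y) :
    IsDistLim s (fun j n => accum (fun l => bump (j + 2) (dist x (y l.unpair.1)))
      fun l => if γ l.unpair.1 (j + 2) = n then (1 : ℝ) else 0) (e x) := by
  have hs := fun j => exists_one_lt_sum_bump hy j x
  refine ⟨fun j => ⟨accum_indicator_nonneg (fun _ => bump_nonneg _ _) (hs _) _,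
    hasSum_accum_indicator (fun _ => bump_nonneg _ _) (hs _) _⟩, fun ξ hξ => ?_⟩
  have hd : ∀ j, dist (s (ξ j)) (e x) ≤ 1 / 2 ^ (j + 1) := fun j => by
    obtain ⟨l, hl, hlξ⟩ := exists_of_accum_indicator_pos
      (fun _ => bump_nonneg _ _) (hs (j + 2)) (hξ j)
    have h1 := bump_pos_iff.1 hl
    have h2 := hγ l.unpair.1 (j + 2)
    rw [hlξ] at h2
    rw [← he.dist_eq] at h1
    have h3 := dist_triangle_right (s (ξ j)) (e x) (e (y l.unpair.1))
    have e1 : (1 : ℝ) / 2 ^ (j + 2) + 1 / 2 ^ (j + 2) = 1 / 2 ^ (j + 1) := by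
      rw [pow_succ _ (j + 1)]; field_simp; norm_num
    linarith
  refine ⟨fun j => ?_, ?_⟩
  · have e1 : (1 : ℝ) / 2 ^ (j + 1) + 1 / 2 ^ (j + 1) = 1 / 2 ^ j := by
      rw [pow_succ]; field_simp; norm_num
    have e2 : (1 : ℝ) / 2 ^ (j + 1 + 1) ≤ 1 / 2 ^ (j + 1) := by
      gcongr
      · norm_num
      · omega
    linarith [dist_triangle_right (s (ξ j)) (s (ξ (j + 1))) (e x), hd j, hd (j + 1)]
  · rw [tendsto_iff_dist_tendsto_zero]
    refine squeeze_zero (fun _ => dist_nonneg) (g := fun j => (1 / 2) ^ (j + 1))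
      (fun j => by rw [div_pow, one_pow]; exact hd j) ?_
    exact (tendsto_add_atTop_iff_nat 1).2
      (tendsto_pow_atTop_nhds_zero_of_lt_one (by norm_num) (by norm_num))

theorem modLim_accum_eq {E V : Type} [NormedAddCommGroup E] [NormedSpace ℝ E] [CompleteSpace E]
    [MetricSpace V] {y : ℕ → E} (hy : DenseRange y) {s : ℕ → V} (hs : DenseRange s) {e : E → V}
    (he : Isometry e) {c : ℕ → ℕ → ℕ}
    (hc : ∀ j n m, dist (s n) (e (y m)) < 1 / 2 ^ j → dist (y (c j n)) (y m) ≤ 38 / 2 ^ j) (x : E) :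
    modLim (fun j => accum (fun l => bump (j + 8) (dist (e x) (s l.unpair.1)))
      fun l => y (c (j + 8) l.unpair.1)) = x := by
  refine modLim_eq fun j => norm_accum_sub_le (fun _ => bump_nonneg _ _)
    (exists_one_lt_sum_bump hs _ _) fun l hl => ?_
  have hlt : dist (s l.unpair.1) (e x) < 1 / 2 ^ (j + 8) := by
    rw [dist_comm]
    exact bump_pos_iff.1 hl
  -- `hc` speaks of dense points only; the strict inequality leaves room to replace `x` by some `y
  -- m`.
  obtain ⟨m, hm⟩ := hy.exists_dist_lt x (sub_pos.2 hlt)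
  have h1 : dist (s l.unpair.1) (e (y m)) < 1 / 2 ^ (j + 8) := by
    have h := dist_triangle (s l.unpair.1) (e x) (e (y m))
    rw [he.dist_eq] at h
    linarith
  have h2 := hc _ _ _ h1
  have h3 := dist_triangle_right (y (c (j + 8) l.unpair.1)) x (y m)
  have h4 := dist_nonneg (x := s l.unpair.1) (y := e x)
  -- The shift by 8 absorbs the constant: 38 + 1 is below `2 ^ 7`.
  have e1 : (38 : ℝ) / 2 ^ (j + 8) + 1 / 2 ^ (j + 8) ≤ 1 / 2 ^ (j + 1) := by
    rw [← add_div, div_le_div_iff₀ (by positivity) (by positivity), pow_add, pow_add]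
    nlinarith [show (0 : ℝ) < 2 ^ j by positivity]
  rw [← dist_eq_norm]
  linarith

theorem totComp_embedding (i : Fin k) {γ : ℕ → ℕ → ℕ} (hγc : Computable₂ γ)
    {e : (M i).carrier → U.carrier}
    (h : ∀ x, IsDistLim U.pt (fun j n =>
      accum (fun l => bump (j + 2) (dist x ((M i).pt l.unpair.1)))
        fun l => if γ l.unpair.1 (j + 2) = n then (1 : ℝ) else 0) (e x)) :
    TotComp U M (.base (.ban i)) (.base .met) e := by
  let A : Ty k := .prod (.prod (.base (.ban i)) (.prod (.base .nat) (.base .nat))) (.base .nat)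
  have hq : TotComp U M A A fun q => q := .id _
  have hx : TotComp U M A (.base (.ban i)) fun q => q.1.1 := hq.fst.fst
  have hj : TotComp U M A (.base .nat) fun q => q.1.2.1 + 2 := hq.fst.snd.fst.succ.succ
  have hn : TotComp U M A (.base .nat) fun q => q.1.2.2 := hq.fst.snd.snd
  have hl : TotComp U M A (.base .nat) fun q => (q.2 : ℕ).unpair.1 := hq.snd.unpairFst
  have h1 := TotComp.bump hj (TotComp.banDist i hx (TotComp.banPt i hl))
  have h2 := TotComp.indicator (TotComp.of_computable₂ hγc hl hj) hn
  have h3 := TotComp.realAccum h1 h2 (fun _ _ => bump_nonneg _ _)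
    fun a => exists_one_lt_sum_bump (M i).dense (a.2.1 + 2) a.1
  exact TotComp.metDistLim h3 h

/-- Totality on `U` needs only that `c` is total: where its values are meaningless, the modified
limit still exists. -/
theorem totComp_retraction (i : Fin k) {c : ℕ → ℕ → ℕ} (hcc : Computable₂ c) :
    TotComp U M (.base .met) (.base (.ban i)) fun u : U.carrier =>
      modLim fun j => accum (fun l => bump (j + 8) (dist u (U.pt l.unpair.1)))
        fun l => (M i).pt (c (j + 8) l.unpair.1) := by
  let A : Ty k := .prod (.prod (.base .met) (.base .nat)) (.base .nat)
  have hq : TotComp U M A A fun q => q := .id _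
  have hu : TotComp U M A (.base .met) fun q => q.1.1 := hq.fst.fst
  have hj : TotComp U M A (.base .nat) fun q => q.1.2 + 8 :=
    hq.fst.snd.succ.succ.succ.succ.succ.succ.succ.succ
  have hl : TotComp U M A (.base .nat) fun q => (q.2 : ℕ).unpair.1 := hq.snd.unpairFst
  have h1 := TotComp.bump hj (TotComp.metDist hu (TotComp.metPt hl))
  have h2 := TotComp.banPt i (TotComp.of_computable₂ hcc hj hl)
  have h3 := TotComp.banAccum i h1 h2 (fun _ _ => bump_nonneg _ _)
    fun a => exists_one_lt_sum_bump U.dense (a.2 + 8) a.1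
  exact TotComp.banModLim i h3

theorem exists_retraction_base (hU : U.IsUrysohn) (i : Fin k) :
    ∃ (e : (M i).carrier → U.carrier) (r : U.carrier → (M i).carrier),
      Continuous e ∧ Continuous r ∧ (∀ x, r (e x) = x) ∧
      TotComp U M (.base (.ban i)) (.base .met) e ∧
      TotComp U M (.base .met) (.base (.ban i)) r := by
  obtain ⟨p, γ, c, hγc, hcc, hp, hγ, hc⟩ := exists_effective_embedding hU (M i).computableDist
  obtain ⟨e, he, hep⟩ := exists_isometry_extension (M i).dense hp
  simp only [← hep] at hγ hc
  refine ⟨e, _, he.continuous, continuous_modLim fun j => ?_,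
    modLim_accum_eq (M i).dense U.dense he hc,
    totComp_embedding M i hγc (isDistLim_accum (M i).dense he hγ), totComp_retraction M i hcc⟩
  exact continuous_accum (fun l => (continuous_bump _).comp (continuous_id.dist continuous_const))
    (fun _ _ => bump_nonneg _ _) (exists_one_lt_sum_bump U.dense _) _

/-- The space of the type `A` is a retract of that of `B`, by internally computable maps. -/
def IsRetract (A B : Ty k) : Prop :=
  ∃ (e : LimSpace.Hom (A.space U M) (B.space U M)) (r : LimSpace.Hom (B.space U M) (A.space U M)),
    (∀ x, r (e x) = x) ∧ TotComp U M A B e.toFun ∧ TotComp U M B A r.toFun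

/-- Composition on both sides. -/
def LimSpace.Hom.conj {L L' K K' : LimSpace} (f : LimSpace.Hom L' L) (g : LimSpace.Hom K K') :
    LimSpace.Hom (L.fn K) (L'.fn K') where
  toFun F := ⟨fun x => g (F (f x)), fun s x h => g.map_lim _ _ (F.map_lim _ _ (f.map_lim s x h))⟩
  map_lim _ _ h s x hs := g.map_lim _ _ (h _ _ (f.map_lim s x hs))

theorem totComp_conj {A A' B B' : Ty k} {f : LimSpace.Hom (A'.space U M) (A.space U M)}
    {g : LimSpace.Hom (B.space U M) (B'.space U M)} (hf : TotComp U M A' A f.toFun)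
    (hg : TotComp U M B B' g.toFun) :
    TotComp U M (.arrow A B) (.arrow A' B') (LimSpace.Hom.conj f g).toFun := by
  have hp : TotComp U M (.prod (.arrow A B) A') (.prod (.arrow A B) A') fun p => p := .id _
  exact TotComp.curry (hg.comp (hp.fst.app (hf.comp hp.snd)))

theorem IsRetract.arrow {A A' B B' : Ty k} (hA : IsRetract M (U := U) A A')
    (hB : IsRetract M (U := U) B B') : IsRetract M (U := U) (.arrow A B) (.arrow A' B') := by
  obtain ⟨e, r, h, he, hr⟩ := hA
  obtain ⟨e', r', h', he', hr'⟩ := hB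
  -- The argument type is contravariant, so its retraction `r` enters the embedding and its
  -- embedding `e` the retraction.
  refine ⟨LimSpace.Hom.conj r e', LimSpace.Hom.conj e r', fun F => ?_, totComp_conj M hr he',
    totComp_conj M he hr'⟩
  cases F with
  | mk F hF =>
    change LimSpace.Hom.mk _ _ = _
    congr 1
    funext x
    exact (h' _).trans (congrArg F (h x))

theorem isRetract_base (hU : U.IsUrysohn) (i : Fin k) :
    IsRetract M (U := U) (.base (.ban i)) (.base .met) := by
  obtain ⟨e, r, he, hr, h, hec, hrc⟩ := exists_retraction_base M hU i
  exact ⟨⟨e, fun _ x hs => (he.tendsto x).comp hs⟩, ⟨r, fun _ x hs => (hr.tendsto x).comp hs⟩, h,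
    hec, hrc⟩

end Retraction

end BanachTypes

theorem mainTheorem8 {k : ℕ} (σ : FinType k) (M : Fin k → ComputableBanachSpace)
    (U : ComputableMetricSpace) (hU : U.IsUrysohn) :
    ∃ (e : LimSpace.Hom ((σ.subst Base.ban).space U M) ((σ.subst fun _ => Base.met).space U M))
      (r : LimSpace.Hom ((σ.subst fun _ => Base.met).space U M) ((σ.subst Base.ban).space U M)),
      (∀ x, r (e x) = x) ∧
      InternallyComputable U M (A := σ.subst Base.ban) (B := σ.subst fun _ => Base.met)
        (tot e.toFun) ∧
      InternallyComputable U M (A := σ.subst fun _ => Base.met) (B := σ.subst Base.ban)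
        (tot r.toFun) := by
  induction σ with
  | var i => exact isRetract_base M hU i
  | arrow δ τ hδ hτ => exact IsRetract.arrow M hδ hτ
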